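/- Let $\mathbb H=\{z=x+iy: y>0\}$. For smooth $f:\mathbb H\to\mathbb C$ and $k\in\{0,2\}$ let $$\Delta_k f= y^2\Big(\frac{\partial^2 f}{\partial x^2}+\frac{\partial^2 f}{\partial y^2}\Big)-iky\Big(\frac{\partial f}{\partial x}+i\frac{\partial f}{\partial y}\Big),\qquad \xi_k f=2i\,y^k\,\overline{\frac{\partial f}{\partial\bar z}},\qquad \frac{\partial}{\partial \bar z}=\frac12\Big(\frac{\partial}{\partial x}+i\frac{\partial}{\partial y}\Big).$$ For $\Re(s)>1-\frac k2$ let $$E_k(z,s)=\frac12\sum_{(m,n)\in\mathbb Z^2\setminus\{(0,0)\}}\frac{y^s}{(mz+n)^k|mz+n|^{2s}} .$$ Then for each $z\in\mathbb H$ the functions $$s(s-1)\,\pi^{-s}\,\Gamma(s)\,E_0(z,s)\qquad\text{and}\qquad (s+1)s\,\pi^{-(s+1)}\,\Gamma(s+2)\,E_2(z,s)$$ continue to entire functions $\widehat{\widehat E}_0(z,s)$ and $\widehat{\widehat E}_2(z,s)$ of $s\in\mathbb C$. Define $F_n$ and $G_n$ by the Taylor expansions $$\widehat{\widehat E}_0(z,s)=\sum_{n\ge0}F_n(z)s^n,\qquad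 \widehat{\widehat E}_2(z,s)=\sum_{n\ge0}G_n(z)s^n,$$ and put, for $n\ge 0$, $$\widetilde F_n=(-1)^n\Big(F_n+\sum_{\ell=1}^n\binom{n+\ell}{n}F_{n-\ell}\Big),\qquad \widetilde G_n=G_n+\sum_{\ell=1}^n(-1)^\ell\binom{n+\ell}{n}G_{n-\ell},$$ and $\widetilde F_{-1}=\widetilde G_{-1}=0$. Then for every $n\ge0$ the functions $\widetilde F_n$ and $\widetilde G_n$ are smooth on $\mathbb H$, and 1. $\Delta_0\widetilde F_n=\widetilde F_{n-1}$ and $\xi_0\widetilde F_n=\widetilde G_n$; 2. $\Delta_2\widetilde G_n=\widetilde G_{n-1}$ and $\xi_2\widetilde G_n=\widetilde F_{n-1}$. -/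

import Mathlib

open scoped UpperHalfPlane ContDiff Nat

noncomputable section

namespace PolyharmonicMaass

/-- The partial derivative `∂f/∂x` of a function on the upper half-plane, `z = x + iy`. -/
def partialX (f : ℍ → ℂ) (z : ℍ) : ℂ :=
  lineDeriv ℝ (fun w : ℂ => f (UpperHalfPlane.ofComplex w)) (z : ℂ) 1

/-- The partial derivative `∂f/∂y` of a function on the upper half-plane, `z = x + iy`. -/
def partialY (f : ℍ → ℂ) (z : ℍ) : ℂ :=
  lineDeriv ℝ (fun w : ℂ => f (UpperHalfPlane.ofComplex w)) (z : ℂ) Complex.I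

/-- The Wirtinger derivative `∂f/∂z̄ = (1/2) (∂f/∂x + i ∂f/∂y)`. -/
def dbar (f : ℍ → ℂ) (z : ℍ) : ℂ :=
  (1 / 2) * (partialX f z + Complex.I * partialY f z)

/-- The weight `k` hyperbolic Laplacian
`Δ_k = y² (∂²/∂x² + ∂²/∂y²) - i k y (∂/∂x + i ∂/∂y)`. -/
def laplacian (k : ℤ) (f : ℍ → ℂ) (z : ℍ) : ℂ :=
  (z.im : ℂ) ^ 2 * (partialX (partialX f) z + partialY (partialY f) z)
    - Complex.I * k * z.im * (partialX f z + Complex.I * partialY f z)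

/-- The operator `ξ_k f = 2 i y^k · conj (∂f/∂z̄)`. -/
def xi (k : ℤ) (f : ℍ → ℂ) (z : ℍ) : ℂ :=
  2 * Complex.I * (z.im : ℂ) ^ k * (starRingEnd ℂ) (dbar f z)

/-- `f` is infinitely differentiable as a function of the two real variables `x, y`. -/
def IsSmooth (f : ℍ → ℂ) : Prop :=
  ContDiffOn ℝ ∞ (fun w : ℂ => f (UpperHalfPlane.ofComplex w)) {w : ℂ | 0 < w.im}

/-- The weight `k` non-holomorphic Eisenstein series
`E_k(z, s) = (1/2) ∑_{(m,n) ≠ (0,0)} y^s / ((mz+n)^k |mz+n|^{2s})`,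
absolutely convergent for `Re s > 1 - k/2`. -/
def eisensteinSeries (k : ℤ) (z : ℍ) (s : ℂ) : ℂ :=
  (1 / 2) * ∑' p : {p : ℤ × ℤ // p ≠ (0, 0)},
    (z.im : ℂ) ^ s /
      (((p.1.1 : ℂ) * z + p.1.2) ^ k * ((‖(p.1.1 : ℂ) * z + p.1.2‖ : ℝ) : ℂ) ^ (2 * s))

/-- `f` is an entire function of `s` that agrees, for `Re s > 1 - k/2`, with
`(s + k/2) (s + k/2 - 1) π^{-(s + k/2)} Γ(s + k/2 + |k|/2) E_k(z, s)`. -/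
def IsDoublyCompleted (k : ℤ) (z : ℍ) (f : ℂ → ℂ) : Prop :=
  Differentiable ℂ f ∧
    ∀ s : ℂ, 1 - (k : ℝ) / 2 < s.re →
      f s = (s + (k : ℂ) / 2) * (s + (k : ℂ) / 2 - 1) *
        ((Real.pi : ℂ) ^ (-(s + (k : ℂ) / 2)) *
          Complex.Gamma (s + (k : ℂ) / 2 + ((|k| : ℤ) : ℂ) / 2) * eisensteinSeries k z s)

/-- The doubly completed Eisenstein series of weight `k`, as a function of `s ∈ ℂ`: the entire
function with the property `IsDoublyCompleted` (at most one function has it, by the identity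
theorem; that one exists for the weights in use is part of what the main theorem asserts). -/
def doublyCompleted (k : ℤ) (z : ℍ) : ℂ → ℂ :=
  Classical.epsilon (IsDoublyCompleted k z)

/-- The coefficient of `s ^ n` in the Taylor expansion at `s = 0` of the doubly completed
Eisenstein series of weight `k`. -/
def taylorCoeff (k : ℤ) (n : ℕ) (z : ℍ) : ℂ :=
  iteratedDeriv n (doublyCompleted k z) 0 / (n ! : ℂ)

/-- The Taylor basis function `F_n` of weight `0`. -/
def F (n : ℕ) : ℍ → ℂ := taylorCoeff 0 n

/-- The Taylor basis function `G_n` of weight `2`. -/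
def G (n : ℕ) : ℍ → ℂ := taylorCoeff 2 n

/-- The symmetrized Taylor basis function `F̃_n` of weight `0`. -/
def symF (n : ℕ) (z : ℍ) : ℂ :=
  (-1) ^ n * (F n z + ∑ l ∈ Finset.Icc 1 n, ((n + l).choose n : ℂ) * F (n - l) z)

/-- The symmetrized Taylor basis function `G̃_n` of weight `2`. -/
def symG (n : ℕ) (z : ℍ) : ℂ :=
  G n z + ∑ l ∈ Finset.Icc 1 n, (-1) ^ l * ((n + l).choose n : ℂ) * G (n - l) z

end PolyharmonicMaass

end

/-!
The Taylor coefficients of the doubly completed `E₀` are, up to the shifts coming from the factor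
`s (s - 1)`, integrals over `t > 1` of the theta series `θ(t) = ∑ exp (-π t |mz + n|² / y)` against
powers of `log t`. The exponents are linear in the entries of the Gram matrix of the form
`|mz + n|² / y`, so these integrals are Laplace transforms: they are smooth in `z` and `ξ₀` and `Δ₀`
may be applied under the integral. There `ξ₀` and `Δ₀` turn `θ` into theta series whose Mellin
transforms are the weight `2` Eisenstein series and `s (s - 1)` times the weight `0` one, and whose
functional equations follow by differentiating that of `θ`. Hence `ξ₀ F_n = (-1)ⁿ G_n` and
`Δ₀ F_{n+2} = F_n - F_{n+1}`; Pascal's rule turns the latter into `Δ₀ F̃_n = F̃_{n-1}`, and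
weight `2` follows from `ξ₂ ξ₀ = Δ₀` and `ξ₀ ξ₂ = Δ₂`.
-/

namespace PolyharmonicMaass

open Complex (I)
open ComplexConjugate

/-! ### Calculus on the upper half-plane -/

/-- The open upper half-plane as a subset of `ℂ`. -/
def halfPlane : Set ℂ := {w : ℂ | 0 < w.im}

lemma isOpen_halfPlane : IsOpen halfPlane :=
  isOpen_lt continuous_const Complex.continuous_im

lemma halfPlane_mem_nhds (z : ℍ) : halfPlane ∈ nhds (z : ℂ) :=
  isOpen_halfPlane.mem_nhds z.im_pos

/-- The extension of a function on `ℍ` to `ℂ` through `UpperHalfPlane.ofComplex`; only its values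
on `halfPlane` are meaningful. -/
noncomputable def extend (f : ℍ → ℂ) (w : ℂ) : ℂ := f (UpperHalfPlane.ofComplex w)

lemma extend_coe (f : ℍ → ℂ) (z : ℍ) : extend f z = f z := by
  simp [extend]

/-- The derivative of a function on `ℍ` in the direction `v`; the directions `1` and `I` give
`partialX` and `partialY`. -/
noncomputable def dirDeriv (v : ℂ) (f : ℍ → ℂ) (z : ℍ) : ℂ := lineDeriv ℝ (extend f) (z : ℂ) v

lemma dbar_eq_dirDeriv (f : ℍ → ℂ) (z : ℍ) :
    dbar f z = 1 / 2 * (dirDeriv 1 f z + I * dirDeriv I f z) := rfl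

lemma laplacian_eq_dirDeriv (k : ℤ) (f : ℍ → ℂ) (z : ℍ) :
    laplacian k f z =
      (z.im : ℂ) ^ 2 * (dirDeriv 1 (dirDeriv 1 f) z + dirDeriv I (dirDeriv I f) z)
        - I * k * z.im * (dirDeriv 1 f z + I * dirDeriv I f z) := rfl

section Smooth

variable {f g : ℍ → ℂ}

lemma IsSmooth.contDiffAt (hf : IsSmooth f) (z : ℍ) : ContDiffAt ℝ ∞ (extend f) (z : ℂ) :=
  ContDiffOn.contDiffAt hf (halfPlane_mem_nhds z)

lemma isSmooth_of_contDiffAt (hf : ∀ z : ℍ, ContDiffAt ℝ ∞ (extend f) (z : ℂ)) : IsSmooth f :=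
  fun w hw => (hf ⟨w, hw⟩).contDiffWithinAt

lemma isSmooth_const (c : ℂ) : IsSmooth (fun _ => c) := contDiffOn_const

lemma IsSmooth.add (hf : IsSmooth f) (hg : IsSmooth g) : IsSmooth (fun z => f z + g z) :=
  ContDiffOn.add hf hg

lemma IsSmooth.mul (hf : IsSmooth f) (hg : IsSmooth g) : IsSmooth (fun z => f z * g z) :=
  ContDiffOn.mul hf hg

lemma IsSmooth.const_mul (hf : IsSmooth f) (c : ℂ) : IsSmooth (fun z => c * f z) :=
  (isSmooth_const c).mul hf

lemma IsSmooth.conj (hf : IsSmooth f) : IsSmooth (fun z => conj (f z)) :=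
  (Complex.conjCLE.contDiff.contDiffOn (s := Set.univ)).comp hf (Set.mapsTo_univ _ _)

lemma IsSmooth.sum {ι : Type*} {s : Finset ι} {f : ι → ℍ → ℂ} (hf : ∀ i ∈ s, IsSmooth (f i)) :
    IsSmooth (fun z => ∑ i ∈ s, f i z) := ContDiffOn.sum hf

lemma IsSmooth.differentiableAt (hf : IsSmooth f) (z : ℍ) :
    DifferentiableAt ℝ (extend f) (z : ℂ) :=
  (hf.contDiffAt z).differentiableAt (by simp)

lemma IsSmooth.contDiffAt_fderiv (hf : IsSmooth f) (z : ℍ) :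
    ContDiffAt ℝ ∞ (fderiv ℝ (extend f)) (z : ℂ) :=
  (hf.contDiffAt z).fderiv_right (by simp)

lemma IsSmooth.dirDeriv_eq (hf : IsSmooth f) (v : ℂ) (z : ℍ) :
    dirDeriv v f z = fderiv ℝ (extend f) z v :=
  (hf.differentiableAt z).lineDeriv_eq_fderiv

lemma IsSmooth.extend_dirDeriv_eventuallyEq (hf : IsSmooth f) (v : ℂ) (z : ℍ) :
    extend (dirDeriv v f) =ᶠ[nhds (z : ℂ)] fun w => fderiv ℝ (extend f) w v := by
  filter_upwards [halfPlane_mem_nhds z] with w hw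
  exact (extend_coe (dirDeriv v f) ⟨w, hw⟩).trans (hf.dirDeriv_eq v ⟨w, hw⟩)

lemma isSmooth_dirDeriv (hf : IsSmooth f) (v : ℂ) : IsSmooth (dirDeriv v f) :=
  isSmooth_of_contDiffAt fun z => ((hf.contDiffAt_fderiv z).clm_apply
    contDiffAt_const).congr_of_eventuallyEq (hf.extend_dirDeriv_eventuallyEq v z)

lemma dirDeriv_dirDeriv_eq_fderiv_fderiv (hf : IsSmooth f) (u v : ℂ) (z : ℍ) :
    dirDeriv u (dirDeriv v f) z = fderiv ℝ (fderiv ℝ (extend f)) z u v := by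
  rw [(isSmooth_dirDeriv hf v).dirDeriv_eq, (hf.extend_dirDeriv_eventuallyEq v z).fderiv_eq,
    fderiv_clm_apply ((hf.contDiffAt_fderiv z).differentiableAt (by simp))
      (differentiableAt_const _)]
  simp

lemma dirDeriv_comm (hf : IsSmooth f) (u v : ℂ) (z : ℍ) :
    dirDeriv u (dirDeriv v f) z = dirDeriv v (dirDeriv u f) z := by
  rw [dirDeriv_dirDeriv_eq_fderiv_fderiv hf, dirDeriv_dirDeriv_eq_fderiv_fderiv hf]
  exact (hf.contDiffAt z).isSymmSndFDerivAt (by simpa using ENat.LEInfty.out) u v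

lemma dirDeriv_const (v c : ℂ) : dirDeriv v (fun _ => c) = fun _ => 0 := by
  funext z
  have h : extend (fun _ => c) = fun _ => c := rfl
  simp [(isSmooth_const c).dirDeriv_eq, h]

lemma dirDeriv_add (hf : IsSmooth f) (hg : IsSmooth g) (v : ℂ) :
    dirDeriv v (fun z => f z + g z) = fun z => dirDeriv v f z + dirDeriv v g z := by
  funext z
  rw [(hf.add hg).dirDeriv_eq, hf.dirDeriv_eq, hg.dirDeriv_eq]
  exact congrArg (fun L => L v) (fderiv_add (hf.differentiableAt z) (hg.differentiableAt z))

lemma dirDeriv_mul (hf : IsSmooth f) (hg : IsSmooth g) (v : ℂ) :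
    dirDeriv v (fun z => f z * g z) = fun z => f z * dirDeriv v g z + g z * dirDeriv v f z := by
  funext z
  rw [(hf.mul hg).dirDeriv_eq, hf.dirDeriv_eq, hg.dirDeriv_eq]
  refine (congrArg (fun L => L v)
    (fderiv_mul (hf.differentiableAt z) (hg.differentiableAt z))).trans ?_
  simp [extend_coe]

lemma dirDeriv_const_mul (hf : IsSmooth f) (c v : ℂ) :
    dirDeriv v (fun z => c * f z) = fun z => c * dirDeriv v f z := by
  simp only [dirDeriv_mul (isSmooth_const c) hf, dirDeriv_const, mul_zero, add_zero]

lemma dirDeriv_conj (hf : IsSmooth f) (v : ℂ) :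
    dirDeriv v (fun z => conj (f z)) = fun z => conj (dirDeriv v f z) := by
  funext z
  rw [hf.conj.dirDeriv_eq, hf.dirDeriv_eq]
  exact congrArg (fun L => L v) (Complex.conjCLE.toContinuousLinearMap.hasFDerivAt.comp (z : ℂ)
    (hf.differentiableAt z).hasFDerivAt).fderiv

lemma extend_im_eventuallyEq (z : ℍ) :
    extend (fun z => (z.im : ℂ)) =ᶠ[nhds (z : ℂ)] Complex.ofRealCLM.comp Complex.imCLM := by
  filter_upwards [halfPlane_mem_nhds z] with w hw
  exact extend_coe (fun z => (z.im : ℂ)) ⟨w, hw⟩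

lemma isSmooth_im : IsSmooth (fun z => (z.im : ℂ)) :=
  isSmooth_of_contDiffAt fun z => (ContinuousLinearMap.contDiff _).contDiffAt.congr_of_eventuallyEq
    (extend_im_eventuallyEq z)

lemma dirDeriv_im (v : ℂ) : dirDeriv v (fun z => (z.im : ℂ)) = fun _ => (v.im : ℂ) := by
  funext z
  rw [isSmooth_im.dirDeriv_eq, (extend_im_eventuallyEq z).fderiv_eq, ContinuousLinearMap.fderiv]
  rfl

lemma isSmooth_dbar (hf : IsSmooth f) : IsSmooth (dbar f) :=
  ((isSmooth_dirDeriv hf 1).add ((isSmooth_dirDeriv hf I).const_mul I)).const_mul (1 / 2)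

lemma dirDeriv_dbar (hf : IsSmooth f) (v : ℂ) (z : ℍ) :
    dirDeriv v (dbar f) z =
      1 / 2 * (dirDeriv v (dirDeriv 1 f) z + I * dirDeriv v (dirDeriv I f) z) := by
  have hx := isSmooth_dirDeriv hf 1
  have hy := isSmooth_dirDeriv hf I
  change dirDeriv v (fun z => 1 / 2 * (dirDeriv 1 f z + I * dirDeriv I f z)) z = _
  rw [dirDeriv_const_mul (hx.add (hy.const_mul I)), dirDeriv_add hx (hy.const_mul I),
    dirDeriv_const_mul hy]

lemma dbar_mul (hf : IsSmooth f) (hg : IsSmooth g) :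
    dbar (fun z => f z * g z) = fun z => f z * dbar g z + g z * dbar f z := by
  funext z
  simp only [dbar_eq_dirDeriv, dirDeriv_mul hf hg]
  ring

lemma dbar_im (z : ℍ) : dbar (fun z => (z.im : ℂ)) z = I / 2 := by
  simp [dbar_eq_dirDeriv, dirDeriv_im, div_eq_inv_mul]

lemma dbar_conj_dbar (hf : IsSmooth f) (z : ℍ) :
    dbar (fun z => conj (dbar f z)) z =
      conj (1 / 4 * (dirDeriv 1 (dirDeriv 1 f) z + dirDeriv I (dirDeriv I f) z)) := by
  simp only [dbar_eq_dirDeriv (fun z => conj (dbar f z)), dirDeriv_conj (isSmooth_dbar hf),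
    dirDeriv_dbar hf, dirDeriv_comm hf 1 I, map_mul, map_add, map_div₀, map_one, map_ofNat,
    Complex.conj_I]
  linear_combination (-1 / 4 * conj (dirDeriv I (dirDeriv I f) z)) * Complex.I_sq

end Smooth

section Operators

variable {f g : ℍ → ℂ} {ι : Type*} {s : Finset ι} {h : ι → ℍ → ℂ}

lemma xi_const (k : ℤ) (c : ℂ) (z : ℍ) : xi k (fun _ => c) z = 0 := by
  simp [xi, dbar_eq_dirDeriv, dirDeriv_const]

lemma xi_add (hf : IsSmooth f) (hg : IsSmooth g) (k : ℤ) (z : ℍ) :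
    xi k (fun z => f z + g z) z = xi k f z + xi k g z := by
  simp only [xi, dbar_eq_dirDeriv, dirDeriv_add hf hg, map_mul, map_add]
  ring

lemma xi_const_mul (hf : IsSmooth f) (k : ℤ) (c : ℂ) (z : ℍ) :
    xi k (fun z => c * f z) z = conj c * xi k f z := by
  simp only [xi, dbar_eq_dirDeriv, dirDeriv_const_mul hf, map_mul, map_add]
  ring

lemma xi_sum (hh : ∀ i ∈ s, IsSmooth (h i)) (k : ℤ) (z : ℍ) :
    xi k (fun z => ∑ i ∈ s, h i z) z = ∑ i ∈ s, xi k (h i) z := by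
  classical
  induction s using Finset.induction_on with
  | empty => simpa using xi_const k 0 z
  | insert a s ha ih =>
    rw [Finset.forall_mem_insert] at hh
    simp only [Finset.sum_insert ha, xi_add hh.1 (IsSmooth.sum hh.2), ih hh.2]

lemma laplacian_const (k : ℤ) (c : ℂ) (z : ℍ) : laplacian k (fun _ => c) z = 0 := by
  simp [laplacian_eq_dirDeriv, dirDeriv_const]

lemma laplacian_add (hf : IsSmooth f) (hg : IsSmooth g) (k : ℤ) (z : ℍ) :
    laplacian k (fun z => f z + g z) z = laplacian k f z + laplacian k g z := by
  simp only [laplacian_eq_dirDeriv, dirDeriv_add hf hg,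
    dirDeriv_add (isSmooth_dirDeriv hf _) (isSmooth_dirDeriv hg _)]
  ring

lemma laplacian_const_mul (hf : IsSmooth f) (k : ℤ) (c : ℂ) (z : ℍ) :
    laplacian k (fun z => c * f z) z = c * laplacian k f z := by
  simp only [laplacian_eq_dirDeriv, dirDeriv_const_mul hf,
    dirDeriv_const_mul (isSmooth_dirDeriv hf _)]
  ring

lemma laplacian_sum (hh : ∀ i ∈ s, IsSmooth (h i)) (k : ℤ) (z : ℍ) :
    laplacian k (fun z => ∑ i ∈ s, h i z) z = ∑ i ∈ s, laplacian k (h i) z := by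
  classical
  induction s using Finset.induction_on with
  | empty => simpa using laplacian_const k 0 z
  | insert a s ha ih =>
    rw [Finset.forall_mem_insert] at hh
    simp only [Finset.sum_insert ha, laplacian_add hh.1 (IsSmooth.sum hh.2), ih hh.2]

lemma xi_zero_eq (f : ℍ → ℂ) : xi 0 f = fun z => 2 * I * conj (dbar f z) := by
  funext z
  rw [xi, zpow_zero, mul_one]

lemma isSmooth_xi_zero (hf : IsSmooth f) : IsSmooth (xi 0 f) := by
  rw [xi_zero_eq]
  exact (isSmooth_dbar hf).conj.const_mul _

lemma xi_two_xi_zero (hf : IsSmooth f) (z : ℍ) : xi 2 (xi 0 f) z = laplacian 0 f z := by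
  rw [xi_zero_eq, xi_const_mul (isSmooth_dbar hf).conj, xi, dbar_conj_dbar hf, Complex.conj_conj,
    laplacian_eq_dirDeriv, zpow_ofNat]
  simp only [map_mul, map_ofNat, Complex.conj_I, Int.cast_zero]
  linear_combination (-(z.im : ℂ) ^ 2 * (dirDeriv 1 (dirDeriv 1 f) z +
    dirDeriv I (dirDeriv I f) z)) * Complex.I_sq

lemma xi_zero_xi_two (hf : IsSmooth f) (z : ℍ) : xi 0 (xi 2 f) z = laplacian 2 f z := by
  have hd := (isSmooth_dbar hf).conj
  have hyd := isSmooth_im.mul hd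
  have hxi : xi 2 f = fun z => 2 * I * ((z.im : ℂ) * ((z.im : ℂ) * conj (dbar f z))) := by
    funext z
    rw [xi, zpow_ofNat]
    ring
  rw [hxi, xi_const_mul (isSmooth_im.mul hyd), laplacian_eq_dirDeriv]
  simp only [xi_zero_eq, dbar_mul isSmooth_im hyd, dbar_mul isSmooth_im hd, dbar_conj_dbar hf,
    dbar_im]
  simp only [dbar_eq_dirDeriv f, map_mul, map_add, map_neg, map_div₀, map_ofNat, map_one,
    Complex.conj_conj, Complex.conj_I, Complex.conj_ofReal, Int.cast_ofNat]
  linear_combination (-(z.im : ℂ) ^ 2 * (dirDeriv 1 (dirDeriv 1 f) z +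
    dirDeriv I (dirDeriv I f) z) + 2 * I * z.im * (dirDeriv 1 f z + I * dirDeriv I f z)) *
    Complex.I_sq

end Operators

/-! ### Laplace transforms of vector measures -/

section Laplace

open MeasureTheory Filter Topology

universe u

variable {Ω : Type*} [MeasurableSpace Ω] {μ : Measure Ω}
  {V : Type*} [NormedAddCommGroup V] [NormedSpace ℝ V]
  {E : Type*} [NormedAddCommGroup E]

/-- The vector-valued function `h` is `μ`-integrable against `exp (-δ N)` for each `δ > 0`. -/
structure IsTempered (μ : Measure Ω) (N : Ω → ℝ) (h : Ω → E) : Prop where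
  aestronglyMeasurable : AEStronglyMeasurable h μ
  integrable : ∀ δ : ℝ, 0 < δ → Integrable (fun a => Real.exp (-δ * N a) * ‖h a‖) μ

/-- A family of linear forms `ℓ` is controlled by the weight `N` over the set `U`: it is bounded
by a multiple of `N`, and locally uniformly in `v ∈ U` one has `ℓ v ≤ -δ N`. -/
structure IsControlled (μ : Measure Ω) (N : Ω → ℝ) (ℓ : Ω → V →L[ℝ] ℝ) (U : Set V) : Prop where
  aestronglyMeasurable_weight : AEStronglyMeasurable N μ
  aestronglyMeasurable : AEStronglyMeasurable ℓ μ
  isOpen : IsOpen U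
  norm_le : ∃ C : ℝ, 0 ≤ C ∧ ∀ᵐ a ∂μ, ‖ℓ a‖ ≤ C * N a
  le_neg : ∀ v₀ ∈ U, ∃ δ : ℝ, 0 < δ ∧ ∃ s ∈ 𝓝 v₀, ∀ᵐ a ∂μ, ∀ v ∈ s, ℓ a v ≤ -δ * N a

variable [NormedSpace ℝ E]

/-- The Laplace transform of the vector measure `h μ` along the linear forms `ℓ`. -/
noncomputable def laplaceIntegral (μ : Measure Ω) (ℓ : Ω → V →L[ℝ] ℝ) (h : Ω → E) (v : V) : E :=
  ∫ a, Real.exp (ℓ a v) • h a ∂μ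

variable {N : Ω → ℝ} {ℓ : Ω → V →L[ℝ] ℝ} {U : Set V} {h : Ω → E} {v : V}

lemma mul_exp_neg_mul_le {δ : ℝ} (hδ : 0 < δ) (x : ℝ) :
    x * Real.exp (-δ * x) ≤ 2 / δ * Real.exp (-(δ / 2) * x) := by
  have hx : x ≤ 2 / δ * Real.exp (δ / 2 * x) := by
    calc x = 2 / δ * (δ / 2 * x) := by field_simp
      _ ≤ 2 / δ * Real.exp (δ / 2 * x) := by
          gcongr
          exact (lt_add_one _).le.trans (Real.add_one_le_exp _)
  calc x * Real.exp (-δ * x) ≤ 2 / δ * Real.exp (δ / 2 * x) * Real.exp (-δ * x) := by gcongr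
    _ = 2 / δ * Real.exp (-(δ / 2) * x) := by rw [mul_assoc, ← Real.exp_add]; ring_nf

lemma IsTempered.smulRight (hh : IsTempered μ N h) (hℓ : IsControlled μ N ℓ U) :
    IsTempered μ N (fun a => (ℓ a).smulRight (h a)) := by
  have hm : AEStronglyMeasurable (fun a => (ℓ a).smulRight (h a)) μ :=
    (ContinuousLinearMap.smulRightL ℝ V E).continuous₂.comp_aestronglyMeasurable₂
      hℓ.aestronglyMeasurable hh.aestronglyMeasurable
  refine ⟨hm, fun δ hδ => ?_⟩
  obtain ⟨C, hC, hℓC⟩ := hℓ.norm_le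
  refine ((hh.integrable (δ / 2) (half_pos hδ)).const_mul (C * (2 / δ))).mono' ?_ ?_
  · exact (Real.continuous_exp.comp_aestronglyMeasurable
      (hℓ.aestronglyMeasurable_weight.const_mul _)).mul hm.norm
  · filter_upwards [hℓC] with a ha
    rw [norm_mul, norm_norm, Real.norm_of_nonneg (Real.exp_pos _).le,
      ContinuousLinearMap.norm_smulRight_apply]
    calc Real.exp (-δ * N a) * (‖ℓ a‖ * ‖h a‖)
        ≤ Real.exp (-δ * N a) * (C * N a * ‖h a‖) := by gcongr
      _ = C * ‖h a‖ * (N a * Real.exp (-δ * N a)) := by ring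
      _ ≤ C * ‖h a‖ * (2 / δ * Real.exp (-(δ / 2) * N a)) := by
          gcongr C * ‖h a‖ * ?_
          exact mul_exp_neg_mul_le hδ _
      _ = C * (2 / δ) * (Real.exp (-(δ / 2) * N a) * ‖h a‖) := by ring

lemma IsControlled.aestronglyMeasurable_exp_smul (hℓ : IsControlled μ N ℓ U)
    (hh : AEStronglyMeasurable h μ) (v : V) :
    AEStronglyMeasurable (fun a => Real.exp (ℓ a v) • h a) μ :=
  (Real.continuous_exp.comp_aestronglyMeasurable
    ((ContinuousLinearMap.apply ℝ ℝ v).continuous.comp_aestronglyMeasurable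
      hℓ.aestronglyMeasurable)).smul hh

lemma IsControlled.integrable_exp_smul (hℓ : IsControlled μ N ℓ U) (hh : IsTempered μ N h)
    (hv : v ∈ U) : Integrable (fun a => Real.exp (ℓ a v) • h a) μ := by
  obtain ⟨δ, hδ, s, hs, hle⟩ := hℓ.le_neg v hv
  refine (hh.integrable δ hδ).mono'
    (hℓ.aestronglyMeasurable_exp_smul hh.aestronglyMeasurable v) ?_
  filter_upwards [hle] with a ha
  rw [norm_smul, Real.norm_of_nonneg (Real.exp_pos _).le]
  gcongr
  exact ha v (mem_of_mem_nhds hs)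

theorem hasFDerivAt_laplaceIntegral (hℓ : IsControlled μ N ℓ U) (hh : IsTempered μ N h)
    (hv : v ∈ U) :
    HasFDerivAt (laplaceIntegral μ ℓ h)
      (laplaceIntegral μ ℓ (fun a => (ℓ a).smulRight (h a)) v) v := by
  obtain ⟨δ, hδ, s, hs, hle⟩ := hℓ.le_neg v hv
  have hℓh := hh.smulRight hℓ
  refine hasFDerivAt_integral_of_dominated_of_fderiv_le (𝕜 := ℝ) (s := s)
    (F := fun v a => Real.exp (ℓ a v) • h a)
    (F' := fun v a => Real.exp (ℓ a v) • (ℓ a).smulRight (h a)) hs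
    (Eventually.of_forall (hℓ.aestronglyMeasurable_exp_smul hh.aestronglyMeasurable))
    (hℓ.integrable_exp_smul hh hv)
    (hℓ.aestronglyMeasurable_exp_smul hℓh.aestronglyMeasurable v) ?_ (hℓh.integrable δ hδ) ?_
  · filter_upwards [hle] with a ha w hw
    rw [norm_smul, Real.norm_of_nonneg (Real.exp_pos _).le]
    gcongr
    exact ha w hw
  · refine Eventually.of_forall fun a w _ => ?_
    convert ((ℓ a).hasFDerivAt (x := w)).exp.smul_const (h a) using 1
    ext x
    simp [smul_smul]

theorem contDiffOn_laplaceIntegral {V E : Type u} [NormedAddCommGroup V] [NormedSpace ℝ V]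
    [NormedAddCommGroup E] [NormedSpace ℝ E] {ℓ : Ω → V →L[ℝ] ℝ} {U : Set V} {h : Ω → E}
    (hℓ : IsControlled μ N ℓ U) (hh : IsTempered μ N h) :
    ContDiffOn ℝ ∞ (laplaceIntegral μ ℓ h) U := by
  rw [contDiffOn_infty]
  intro n
  induction n generalizing E with
  | zero =>
    rw [Nat.cast_zero, contDiffOn_zero]
    exact fun v hv => (hasFDerivAt_laplaceIntegral hℓ hh hv).continuousAt.continuousWithinAt
  | succ n ih =>
    rw [Nat.cast_succ, contDiffOn_succ_iff_fderiv_of_isOpen hℓ.isOpen]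
    exact ⟨fun v hv =>
        (hasFDerivAt_laplaceIntegral hℓ hh hv).differentiableAt.differentiableWithinAt,
      by simp, (ih (hh.smulRight hℓ)).congr fun v hv =>
        (hasFDerivAt_laplaceIntegral hℓ hh hv).fderiv⟩

theorem laplaceIntegral_smulRight_apply [CompleteSpace E] (hℓ : IsControlled μ N ℓ U)
    (hh : IsTempered μ N h) (hv : v ∈ U) (u : V) :
    laplaceIntegral μ ℓ (fun a => (ℓ a).smulRight (h a)) v u =
      laplaceIntegral μ ℓ (fun a => ℓ a u • h a) v := by
  rw [laplaceIntegral,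
    ContinuousLinearMap.integral_apply (hℓ.integrable_exp_smul (hh.smulRight hℓ) hv)]
  rfl

end Laplace

/-! ### The quadratic form `|mz + n|² / y` -/

section QuadraticForm

/-- The nonzero vectors of `ℤ²`. -/
abbrev PuncturedLattice : Type := {p : ℤ × ℤ // p ≠ (0, 0)}

/-- The value at `p = (m, n)` of the binary quadratic form `a m² + 2 b m n + c n²`, as a linear
form in the coefficients `(a, b, c)`. -/
noncomputable def quadForm (p : PuncturedLattice) : ℝ × ℝ × ℝ →L[ℝ] ℝ :=
  ((p.1.1 : ℝ) ^ 2) • ContinuousLinearMap.fst ℝ ℝ (ℝ × ℝ) +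
    (2 * (p.1.1 : ℝ) * p.1.2) •
      (ContinuousLinearMap.fst ℝ ℝ ℝ).comp (ContinuousLinearMap.snd ℝ ℝ (ℝ × ℝ)) +
    ((p.1.2 : ℝ) ^ 2) •
      (ContinuousLinearMap.snd ℝ ℝ ℝ).comp (ContinuousLinearMap.snd ℝ ℝ (ℝ × ℝ))

lemma quadForm_apply (p : PuncturedLattice) (v : ℝ × ℝ × ℝ) :
    quadForm p v = (p.1.1 : ℝ) ^ 2 * v.1 + 2 * p.1.1 * p.1.2 * v.2.1 + (p.1.2 : ℝ) ^ 2 * v.2.2 := by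
  simp [quadForm]

/-- The squared Euclidean length of a lattice vector. -/
noncomputable def sqLength (p : PuncturedLattice) : ℝ := (p.1.1 : ℝ) ^ 2 + (p.1.2 : ℝ) ^ 2

lemma vec_ne_zero (p : PuncturedLattice) : ![p.1.1, p.1.2] ≠ 0 := fun h =>
  p.2 (Prod.ext (by simpa using congrFun h 0) (by simpa using congrFun h 1))

lemma norm_vec_sq_le_sqLength (p : PuncturedLattice) : ‖![p.1.1, p.1.2]‖ ^ 2 ≤ sqLength p := by
  have hsq : 0 ≤ sqLength p := add_nonneg (sq_nonneg _) (sq_nonneg _)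
  rw [← Real.sq_sqrt hsq]
  gcongr
  refine (pi_norm_le_iff_of_nonneg (Real.sqrt_nonneg _)).2 fun i => Real.le_sqrt_of_sq_le ?_
  rw [Int.norm_eq_abs, sq_abs, sqLength]
  fin_cases i
  · exact le_add_of_nonneg_right (sq_nonneg _)
  · exact le_add_of_nonneg_left (sq_nonneg _)

lemma sqLength_le_two_mul_norm_vec_sq (p : PuncturedLattice) :
    sqLength p ≤ 2 * ‖![p.1.1, p.1.2]‖ ^ 2 := by
  have hfst : |(p.1.1 : ℝ)| ≤ ‖![p.1.1, p.1.2]‖ := by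
    exact_mod_cast EisensteinSeries.abs_le_left_of_norm p.1.2 p.1.1
  have hsnd : |(p.1.2 : ℝ)| ≤ ‖![p.1.1, p.1.2]‖ := by
    exact_mod_cast EisensteinSeries.abs_le_right_of_norm p.1.2 p.1.1
  rw [sqLength, two_mul, ← sq_abs (p.1.1 : ℝ), ← sq_abs (p.1.2 : ℝ)]
  gcongr

lemma one_le_sqLength (p : PuncturedLattice) : 1 ≤ sqLength p := by
  have hnorm : 1 ≤ ‖![p.1.1, p.1.2]‖ := by
    have hpos := norm_pos_iff.2 (vec_ne_zero p)
    rw [EisensteinSeries.norm_eq_max_natAbs] at hpos ⊢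
    exact_mod_cast hpos
  exact (one_le_pow₀ hnorm).trans (norm_vec_sq_le_sqLength p)

lemma sqLength_pos (p : PuncturedLattice) : 0 < sqLength p :=
  zero_lt_one.trans_le (one_le_sqLength p)

lemma abs_quadForm_le (p : PuncturedLattice) (v : ℝ × ℝ × ℝ) :
    |quadForm p v| ≤ 2 * ‖v‖ * sqLength p := by
  have hmixed : |2 * (p.1.1 : ℝ) * p.1.2| ≤ sqLength p := by
    rw [abs_le, sqLength]
    constructor <;> nlinarith [sq_nonneg ((p.1.1 : ℝ) + p.1.2), sq_nonneg ((p.1.1 : ℝ) - p.1.2)]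
  rw [quadForm_apply]
  calc _ ≤ |(p.1.1 : ℝ) ^ 2 * v.1| + |2 * (p.1.1 : ℝ) * p.1.2 * v.2.1| +
        |(p.1.2 : ℝ) ^ 2 * v.2.2| := abs_add_three _ _ _
    _ = (p.1.1 : ℝ) ^ 2 * |v.1| + |2 * (p.1.1 : ℝ) * p.1.2| * |v.2.1| +
        (p.1.2 : ℝ) ^ 2 * |v.2.2| := by
        rw [abs_mul, abs_mul _ v.2.1, abs_mul _ v.2.2, abs_sq, abs_sq]
    _ ≤ (p.1.1 : ℝ) ^ 2 * ‖v‖ + sqLength p * ‖v‖ + (p.1.2 : ℝ) ^ 2 * ‖v‖ := by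
        gcongr
        · exact norm_fst_le v
        · exact (sqLength_pos p).le
        · exact (norm_fst_le v.2).trans (norm_snd_le v)
        · exact (norm_snd_le v.2).trans (norm_snd_le v)
    _ = _ := by rw [sqLength]; ring

lemma norm_quadForm_le (p : PuncturedLattice) : ‖quadForm p‖ ≤ 2 * sqLength p :=
  ContinuousLinearMap.opNorm_le_bound _ (by linarith [sqLength_pos p]) fun v =>
    (abs_quadForm_le p v).trans_eq (by ring)

/-- The coefficients of binary quadratic forms that are bounded below by a positive multiple of
the Euclidean form on the lattice. -/
def posForms : Set (ℝ × ℝ × ℝ) := {v | ∃ ε : ℝ, 0 < ε ∧ ∀ p, ε * sqLength p ≤ quadForm p v}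

lemma exists_le_quadForm_near {v : ℝ × ℝ × ℝ} (hv : v ∈ posForms) :
    ∃ ε : ℝ, 0 < ε ∧ ∃ s ∈ nhds v, ∀ p, ∀ u ∈ s, ε * sqLength p ≤ quadForm p u := by
  obtain ⟨ε, hε, hle⟩ := hv
  refine ⟨ε / 2, half_pos hε, Metric.ball v (ε / 4), Metric.ball_mem_nhds _ (by positivity),
    fun p u hu => ?_⟩
  have hdiff : |quadForm p u - quadForm p v| ≤ ε / 2 * sqLength p := by
    rw [← map_sub]
    calc |quadForm p (u - v)| ≤ 2 * ‖u - v‖ * sqLength p := abs_quadForm_le p _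
      _ ≤ 2 * (ε / 4) * sqLength p := by
          gcongr
          · exact (sqLength_pos p).le
          · exact (mem_ball_iff_norm.1 hu).le
      _ = ε / 2 * sqLength p := by ring
  linarith [hle p, neg_le_of_abs_le hdiff]

lemma isOpen_posForms : IsOpen posForms := by
  rw [isOpen_iff_mem_nhds]
  intro v hv
  obtain ⟨ε, hε, s, hs, hle⟩ := exists_le_quadForm_near hv
  exact Filter.mem_of_superset hs fun u hu => ⟨ε, hε, fun p => hle p u hu⟩

/-- The coefficients `(|z|²/y, x/y, 1/y)` of the quadratic form `|mz+n|²/y`. -/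
noncomputable def gram (w : ℂ) : ℝ × ℝ × ℝ :=
  ((w.re ^ 2 + w.im ^ 2) / w.im, w.re / w.im, 1 / w.im)

lemma quadForm_gram (p : PuncturedLattice) (z : ℍ) :
    quadForm p (gram z) = ‖(p.1.1 : ℂ) * z + p.1.2‖ ^ 2 / z.im := by
  have hy : z.im ≠ 0 := z.im_ne_zero
  rw [quadForm_apply, ← Complex.normSq_eq_norm_sq, Complex.normSq_apply]
  simp only [gram, UpperHalfPlane.coe_re, UpperHalfPlane.coe_im, Complex.add_re, Complex.mul_re,
    Complex.intCast_re, Complex.intCast_im, zero_mul, sub_zero, Complex.add_im, Complex.mul_im,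
    add_zero]
  field_simp
  ring

lemma gram_mem_posForms (z : ℍ) : gram z ∈ posForms := by
  have hr := EisensteinSeries.r_pos z
  refine ⟨EisensteinSeries.r z ^ 2 / 2 / z.im, by positivity, fun p => ?_⟩
  have hnorm : EisensteinSeries.r z * ‖![p.1.1, p.1.2]‖ ≤ ‖(p.1.1 : ℂ) * z + p.1.2‖ := by
    simpa using EisensteinSeries.r_mul_max_le z (vec_ne_zero p)
  rw [quadForm_gram, div_mul_eq_mul_div]
  gcongr
  calc EisensteinSeries.r z ^ 2 / 2 * sqLength p
      ≤ EisensteinSeries.r z ^ 2 / 2 * (2 * ‖![p.1.1, p.1.2]‖ ^ 2) := by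
        gcongr
        exact sqLength_le_two_mul_norm_vec_sq p
    _ = (EisensteinSeries.r z * ‖![p.1.1, p.1.2]‖) ^ 2 := by ring
    _ ≤ ‖(p.1.1 : ℂ) * z + p.1.2‖ ^ 2 := by gcongr

/-- The derivative of `gram` in the direction `1`. -/
noncomputable def gramX (w : ℂ) : ℝ × ℝ × ℝ := (2 * w.re / w.im, 1 / w.im, 0)

/-- The derivative of `gram` in the direction `I`. -/
noncomputable def gramY (w : ℂ) : ℝ × ℝ × ℝ :=
  (1 - w.re ^ 2 / w.im ^ 2, -w.re / w.im ^ 2, -1 / w.im ^ 2)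

variable {w : ℂ}

lemma contDiffAt_re : ContDiffAt ℝ ∞ Complex.re w := Complex.reCLM.contDiff.contDiffAt

lemma contDiffAt_im : ContDiffAt ℝ ∞ Complex.im w := Complex.imCLM.contDiff.contDiffAt

lemma contDiffAt_gram (hw : w.im ≠ 0) : ContDiffAt ℝ ∞ gram w :=
  (((contDiffAt_re.pow 2).add (contDiffAt_im.pow 2)).fun_div contDiffAt_im hw).prodMk
    ((contDiffAt_re.div contDiffAt_im hw).prodMk (contDiffAt_const.div contDiffAt_im hw))

lemma differentiableAt_gram (hw : w.im ≠ 0) : DifferentiableAt ℝ gram w :=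
  (contDiffAt_gram hw).differentiableAt (by simp)

lemma differentiableAt_gramX (hw : w.im ≠ 0) : DifferentiableAt ℝ gramX w := by
  have h : ContDiffAt ℝ ∞ gramX w := ((contDiffAt_const.mul contDiffAt_re).div contDiffAt_im
    hw).prodMk ((contDiffAt_const.div contDiffAt_im hw).prodMk contDiffAt_const)
  exact h.differentiableAt (by simp)

lemma differentiableAt_gramY (hw : w.im ≠ 0) : DifferentiableAt ℝ gramY w := by
  have hsq : ContDiffAt ℝ ∞ (fun w : ℂ => w.im ^ 2) w := contDiffAt_im.pow 2
  have hw' : w.im ^ 2 ≠ 0 := pow_ne_zero 2 hw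
  have h : ContDiffAt ℝ ∞ gramY w :=
    (contDiffAt_const.sub ((contDiffAt_re.pow 2).div hsq hw')).prodMk
      ((contDiffAt_re.neg.div hsq hw').prodMk (contDiffAt_const.div hsq hw'))
  exact h.differentiableAt (by simp)

lemma fderiv_gram_one (hw : w.im ≠ 0) : fderiv ℝ gram w 1 = gramX w := by
  rw [← (differentiableAt_gram hw).lineDeriv_eq_fderiv]
  refine HasLineDerivAt.lineDeriv (f' := gramX w) ?_
  simp only [HasLineDerivAt, gram, Complex.add_re, Complex.add_im, Complex.real_smul, mul_one,
    Complex.ofReal_re, Complex.ofReal_im, add_zero, gramX]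
  have hre := (hasDerivAt_id (0 : ℝ)).const_add w.re
  refine HasDerivAt.prodMk ?_ ((hre.div_const _).prodMk (hasDerivAt_const _ _))
  exact (((hre.fun_pow 2).add_const (w.im ^ 2)).div_const w.im).congr_deriv (by simp)

lemma fderiv_gramX_one (hw : w.im ≠ 0) : fderiv ℝ gramX w 1 = (2 / w.im, 0, 0) := by
  rw [← (differentiableAt_gramX hw).lineDeriv_eq_fderiv]
  refine HasLineDerivAt.lineDeriv ?_
  simp only [HasLineDerivAt, gramX, Complex.add_re, Complex.add_im, Complex.real_smul, mul_one,
    Complex.ofReal_re, Complex.ofReal_im, add_zero]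
  have hre := (hasDerivAt_id (0 : ℝ)).const_add w.re
  refine HasDerivAt.prodMk ?_ ((hasDerivAt_const _ _).prodMk (hasDerivAt_const _ _))
  exact ((hre.const_mul 2).div_const w.im).congr_deriv (by simp)

lemma fderiv_gram_I (hw : w.im ≠ 0) : fderiv ℝ gram w I = gramY w := by
  rw [← (differentiableAt_gram hw).lineDeriv_eq_fderiv]
  refine HasLineDerivAt.lineDeriv (f' := gramY w) ?_
  simp only [HasLineDerivAt, gram, Complex.add_re, Complex.add_im, Complex.real_smul,
    Complex.re_ofReal_mul, Complex.im_ofReal_mul, Complex.I_re, Complex.I_im, mul_zero, mul_one,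
    add_zero, gramY]
  have him := (hasDerivAt_id (0 : ℝ)).const_add w.im
  have hne : w.im + id (0 : ℝ) ≠ 0 := by simpa using hw
  refine HasDerivAt.prodMk ?_ (HasDerivAt.prodMk ?_ ?_)
  · refine (((him.fun_pow 2).const_add (w.re ^ 2)).fun_div him hne).congr_deriv ?_
    simp only [id_eq, add_zero]
    field_simp
    ring
  · exact ((hasDerivAt_const (0 : ℝ) w.re).fun_div him hne).congr_deriv (by simp)
  · exact ((hasDerivAt_const (0 : ℝ) (1 : ℝ)).fun_div him hne).congr_deriv (by simp)

lemma fderiv_gramY_I (hw : w.im ≠ 0) : fderiv ℝ gramY w I =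
    (2 * w.re ^ 2 / w.im ^ 3, 2 * w.re / w.im ^ 3, 2 / w.im ^ 3) := by
  rw [← (differentiableAt_gramY hw).lineDeriv_eq_fderiv]
  refine HasLineDerivAt.lineDeriv ?_
  simp only [HasLineDerivAt, gramY, Complex.add_re, Complex.add_im, Complex.real_smul,
    Complex.re_ofReal_mul, Complex.im_ofReal_mul, Complex.I_re, Complex.I_im, mul_zero, mul_one,
    add_zero]
  have hdiv (c : ℝ) : HasDerivAt (fun t : ℝ => c / (w.im + t) ^ 2) (-2 * c / w.im ^ 3) 0 := by
    have hne : (w.im + id (0 : ℝ)) ^ 2 ≠ 0 := by simpa using hw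
    refine ((hasDerivAt_const (0 : ℝ) c).fun_div
      (((hasDerivAt_id (0 : ℝ)).const_add w.im).fun_pow 2) hne).congr_deriv ?_
    simp only [id_eq, add_zero]
    field_simp
    ring
  exact (((hdiv _).const_sub 1).congr_deriv (by ring)).prodMk
    (((hdiv _).congr_deriv (by ring)).prodMk ((hdiv _).congr_deriv (by ring)))

lemma fderiv_gramX_add_gramY (hw : w.im ≠ 0) :
    fderiv ℝ gramX w 1 + fderiv ℝ gramY w I = (2 / w.im ^ 2) • gram w := by
  rw [fderiv_gramX_one hw, fderiv_gramY_I hw, gram]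
  simp only [Prod.mk_add_mk, Prod.smul_mk, smul_eq_mul, Prod.mk.injEq]
  refine ⟨?_, ?_, ?_⟩ <;> field_simp <;> ring

lemma quadForm_gramX_gramY (hw : w.im ≠ 0) (p : PuncturedLattice) :
    w.im ^ 2 * (quadForm p (gramX w) ^ 2 + quadForm p (gramY w) ^ 2) = quadForm p (gram w) ^ 2 := by
  simp only [quadForm_apply, gramX, gramY, gram]
  field_simp
  ring

end QuadraticForm

/-! ### Theta series over the nonzero lattice vectors -/

section ThetaSeries

open MeasureTheory Filter Topology

lemma summable_sqLength_rpow {σ : ℝ} (hσ : 1 < σ) :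
    Summable fun p : PuncturedLattice => sqLength p ^ (-σ) := by
  have hinj : Function.Injective (fun p : PuncturedLattice => ![p.1.1, p.1.2]) := fun p q hpq =>
    Subtype.ext (Prod.ext (by simpa using congrFun hpq 0) (by simpa using congrFun hpq 1))
  have hnorm := EisensteinSeries.summable_one_div_norm_rpow (k := 2 * σ) (by linarith)
  refine (hnorm.comp_injective hinj).of_nonneg_of_le
    (fun p => Real.rpow_nonneg (sqLength_pos p).le _) fun p => ?_
  have hpos : 0 < ‖![p.1.1, p.1.2]‖ := norm_pos_iff.2 (vec_ne_zero p)
  rw [Function.comp_apply, show -(2 * σ) = 2 * (-σ) by ring, Real.rpow_mul hpos.le, Real.rpow_two]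
  exact Real.rpow_le_rpow_of_nonpos (by positivity) (norm_vec_sq_le_sqLength p) (by linarith)

lemma summable_exp_neg_sqLength {δ : ℝ} (hδ : 0 < δ) :
    Summable fun p : PuncturedLattice => Real.exp (-δ * sqLength p) := by
  refine ((summable_sqLength_rpow one_lt_two).mul_left (2 / δ ^ 2)).of_nonneg_of_le
    (fun p => (Real.exp_pos _).le) fun p => ?_
  have hp := sqLength_pos p
  have hexp : (δ * sqLength p) ^ 2 / 2 ≤ Real.exp (δ * sqLength p) := by
    simpa using Real.pow_div_factorial_le_exp (δ * sqLength p) (by positivity) 2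
  calc Real.exp (-δ * sqLength p) = (Real.exp (δ * sqLength p))⁻¹ := by rw [neg_mul, Real.exp_neg]
    _ ≤ ((δ * sqLength p) ^ 2 / 2)⁻¹ := by gcongr
    _ = 2 / δ ^ 2 * sqLength p ^ (-2 : ℝ) := by
        rw [Real.rpow_neg hp.le, Real.rpow_two]
        field_simp

/-- The exponent `-π t Q(p)` as a linear form in the coefficients of the quadratic form `Q`. -/
noncomputable def thetaForm (a : PuncturedLattice × ℝ) : ℝ × ℝ × ℝ →L[ℝ] ℝ :=
  (-Real.pi * a.2) • quadForm a.1

lemma thetaForm_apply (p : PuncturedLattice) (t : ℝ) (v : ℝ × ℝ × ℝ) :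
    thetaForm (p, t) v = -Real.pi * t * quadForm p v := rfl

/-- The weight `t |p|²` that controls the exponents `thetaForm`. -/
noncomputable def thetaWeight (a : PuncturedLattice × ℝ) : ℝ := a.2 * sqLength a.1

lemma thetaWeight_nonneg (p : PuncturedLattice) {t : ℝ} (ht : 0 ≤ t) : 0 ≤ thetaWeight (p, t) :=
  mul_nonneg ht (sqLength_pos p).le

/-- The coefficient family `κ` grows more slowly than each `exp (δ t |p|²)`. -/
structure IsSubexponential (κ : PuncturedLattice × ℝ → ℂ) : Prop where
  measurable : Measurable κ
  bound : ∀ δ : ℝ, 0 < δ → ∃ C : ℝ, 0 ≤ C ∧ ∀ p t, 0 < t →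
    ‖κ (p, t)‖ ≤ C * Real.exp (δ * thetaWeight (p, t))

/-- The measure `w ν` on the positive half-line lives away from `0` and is integrable against
each `exp (-δ t)`. -/
structure IsAdmissible (ν : Measure ℝ) (w : ℝ → ℝ) : Prop where
  pos : ∃ c : ℝ, 0 < c ∧ ∀ᵐ t ∂ν, c ≤ t
  aestronglyMeasurable : AEStronglyMeasurable w ν
  integrable : ∀ δ : ℝ, 0 < δ → Integrable (fun t => Real.exp (-δ * t) * ‖w t‖) ν

/-- The theta series with coefficients `κ` of the quadratic form attached to `z`. -/
noncomputable def thetaSeries (κ : PuncturedLattice × ℝ → ℂ) (z : ℍ) (t : ℝ) : ℂ :=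
  ∑' p : PuncturedLattice, Real.exp (thetaForm (p, t) (gram z)) • κ (p, t)

lemma exp_neg_thetaWeight_le {δ c t : ℝ} (hδ : 0 < δ) (hc : 0 < c) (ht : c ≤ t)
    (p : PuncturedLattice) :
    Real.exp (-δ * thetaWeight (p, t)) ≤
      Real.exp (-(δ * c / 2) * sqLength p) * Real.exp (-(δ / 2) * t) := by
  rw [← Real.exp_add]
  refine Real.exp_le_exp.2 ?_
  have hsq : c * sqLength p ≤ t * sqLength p := mul_le_mul_of_nonneg_right ht (sqLength_pos p).le
  have ht' : t ≤ t * sqLength p := le_mul_of_one_le_right (hc.le.trans ht) (one_le_sqLength p)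
  rw [thetaWeight]
  linarith [mul_le_mul_of_nonneg_left (add_le_add hsq ht') (half_pos hδ).le]

lemma exists_exp_thetaForm_le (z : ℍ) : ∃ δ : ℝ, 0 < δ ∧ ∀ (p : PuncturedLattice) (t : ℝ), 0 < t →
    Real.exp (thetaForm (p, t) (gram z)) ≤ Real.exp (-δ * thetaWeight (p, t)) := by
  obtain ⟨ε, hε, hle⟩ := gram_mem_posForms z
  refine ⟨Real.pi * ε, by positivity, fun p t ht => Real.exp_le_exp.2 ?_⟩
  have hpt : 0 ≤ Real.pi * t := by positivity
  rw [thetaForm_apply, thetaWeight]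
  linarith [mul_le_mul_of_nonneg_left (hle p) hpt]

section Subexponential

variable {κ : PuncturedLattice × ℝ → ℂ} {t : ℝ}

lemma IsSubexponential.exists_exp_mul_norm_le (hκ : IsSubexponential κ) {δ : ℝ} (hδ : 0 < δ) :
    ∃ C : ℝ, 0 ≤ C ∧ ∀ (p : PuncturedLattice) (t : ℝ), 0 < t →
      Real.exp (-δ * thetaWeight (p, t)) * ‖κ (p, t)‖ ≤
        C * Real.exp (-(δ / 2) * thetaWeight (p, t)) := by
  obtain ⟨C, hC, hκC⟩ := hκ.bound (δ / 2) (half_pos hδ)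
  refine ⟨C, hC, fun p t ht => ?_⟩
  calc _ ≤ Real.exp (-δ * thetaWeight (p, t)) * (C * Real.exp (δ / 2 * thetaWeight (p, t))) := by
        gcongr
        exact hκC p t ht
    _ = C * Real.exp (-δ * thetaWeight (p, t) + δ / 2 * thetaWeight (p, t)) := by
        rw [Real.exp_add]; ring
    _ = _ := by ring_nf

lemma IsSubexponential.exists_term_le (hκ : IsSubexponential κ) (z : ℍ) :
    ∃ C δ : ℝ, 0 ≤ C ∧ 0 < δ ∧ ∀ (p : PuncturedLattice) (t : ℝ), 0 < t →
      ‖Real.exp (thetaForm (p, t) (gram z)) • κ (p, t)‖ ≤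
        C * Real.exp (-δ * thetaWeight (p, t)) := by
  obtain ⟨δ, hδ, hexp⟩ := exists_exp_thetaForm_le z
  obtain ⟨C, hC, hκC⟩ := hκ.exists_exp_mul_norm_le hδ
  refine ⟨C, δ / 2, hC, half_pos hδ, fun p t ht => ?_⟩
  rw [norm_smul, Real.norm_of_nonneg (Real.exp_pos _).le]
  exact (mul_le_mul_of_nonneg_right (hexp p t ht) (norm_nonneg _)).trans (hκC p t ht)

lemma IsSubexponential.summable_norm (hκ : IsSubexponential κ) (z : ℍ) (ht : 0 < t) :
    Summable fun p : PuncturedLattice => ‖Real.exp (thetaForm (p, t) (gram z)) • κ (p, t)‖ := by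
  obtain ⟨C, δ, -, hδ, hle⟩ := hκ.exists_term_le z
  refine ((summable_exp_neg_sqLength (mul_pos hδ ht)).mul_left C).of_nonneg_of_le
    (fun p => norm_nonneg _) fun p => (hle p t ht).trans_eq ?_
  rw [thetaWeight]
  ring_nf

lemma IsSubexponential.hasSum (hκ : IsSubexponential κ) (z : ℍ) (ht : 0 < t) :
    HasSum (fun p : PuncturedLattice => Real.exp (thetaForm (p, t) (gram z)) • κ (p, t))
      (thetaSeries κ z t) :=
  (hκ.summable_norm z ht).of_norm.hasSum

lemma IsSubexponential.exists_norm_thetaSeries_le (hκ : IsSubexponential κ) (z : ℍ) :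
    ∃ C δ : ℝ, 0 < δ ∧ ∀ t : ℝ, 1 ≤ t → ‖thetaSeries κ z t‖ ≤ C * Real.exp (-δ * t) := by
  obtain ⟨C, δ, hC, hδ, hle⟩ := hκ.exists_term_le z
  have hs := summable_exp_neg_sqLength (δ := δ * 1 / 2) (by positivity)
  refine ⟨C * ∑' p : PuncturedLattice, Real.exp (-(δ * 1 / 2) * sqLength p), δ / 2, half_pos hδ,
    fun t ht => ?_⟩
  have hpos : 0 < t := zero_lt_one.trans_le ht
  refine (norm_tsum_le_tsum_norm (hκ.summable_norm z hpos)).trans ?_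
  rw [mul_assoc, ← tsum_mul_right, ← tsum_mul_left]
  refine (hκ.summable_norm z hpos).tsum_le_tsum (fun p => (hle p t hpos).trans ?_)
    ((hs.mul_right _).mul_left _)
  gcongr
  exact exp_neg_thetaWeight_le hδ one_pos ht p

end Subexponential

lemma measurable_thetaWeight : Measurable thetaWeight :=
  measurable_from_prod_countable_right fun p => by
    simp only [thetaWeight]; fun_prop

lemma stronglyMeasurable_thetaForm : StronglyMeasurable thetaForm := by
  have hfst (c : PuncturedLattice → ℝ) :
      StronglyMeasurable fun a : PuncturedLattice × ℝ => c a.1 :=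
    ((measurable_of_countable c).comp measurable_fst).stronglyMeasurable
  have hsnd : StronglyMeasurable fun a : PuncturedLattice × ℝ => -Real.pi * a.2 :=
    (measurable_snd.const_mul _).stronglyMeasurable
  exact hsnd.smul ((((hfst fun p => (p.1.1 : ℝ) ^ 2).smul_const _).add
    ((hfst fun p => 2 * (p.1.1 : ℝ) * p.1.2).smul_const _)).add
    ((hfst fun p => (p.1.2 : ℝ) ^ 2).smul_const _))

/-- The product of counting measure on the lattice and a measure `ν` on the half-line. -/
noncomputable def thetaMeasure (ν : Measure ℝ) : Measure (PuncturedLattice × ℝ) :=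
  Measure.count.prod ν

/-- The integral over `t` of a theta series with coefficients `κ` against the measure `w ν`. -/
noncomputable def thetaIntegral (ν : Measure ℝ) (w : ℝ → ℝ) (κ : PuncturedLattice × ℝ → ℂ)
    (z : ℍ) : ℂ :=
  ∫ t, thetaSeries κ z t * (w t : ℂ) ∂ν

section Admissible

variable {ν : Measure ℝ} {w : ℝ → ℝ} {κ : PuncturedLattice × ℝ → ℂ}

lemma IsAdmissible.exists_ae_le_snd (hw : IsAdmissible ν w) :
    ∃ c : ℝ, 0 < c ∧ ∀ᵐ a ∂thetaMeasure ν, c ≤ a.2 := by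
  obtain ⟨c, hc, hle⟩ := hw.pos
  exact ⟨c, hc, Measure.quasiMeasurePreserving_snd.ae hle⟩

lemma IsAdmissible.isControlled (hw : IsAdmissible ν w) :
    IsControlled (thetaMeasure ν) thetaWeight thetaForm posForms := by
  obtain ⟨c, hc, hae⟩ := hw.exists_ae_le_snd
  refine ⟨measurable_thetaWeight.aestronglyMeasurable,
    stronglyMeasurable_thetaForm.aestronglyMeasurable, isOpen_posForms,
    ⟨Real.pi * 2, by positivity, ?_⟩, fun v hv => ?_⟩
  · filter_upwards [hae] with a ha
    have hpos : 0 < a.2 := hc.trans_le ha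
    rw [thetaForm, norm_smul, Real.norm_eq_abs, abs_mul, abs_neg, abs_of_pos Real.pi_pos,
      abs_of_pos hpos, thetaWeight]
    calc _ ≤ Real.pi * a.2 * (2 * sqLength a.1) := by
          gcongr
          exact norm_quadForm_le a.1
      _ = _ := by ring
  · obtain ⟨ε, hε, s, hs, hle⟩ := exists_le_quadForm_near hv
    refine ⟨Real.pi * ε, by positivity, s, hs, ?_⟩
    filter_upwards [hae] with ⟨p, t⟩ ha u hu
    have hpt : 0 ≤ Real.pi * t := mul_nonneg Real.pi_pos.le (hc.le.trans ha)
    rw [thetaForm_apply, thetaWeight]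
    linarith [mul_le_mul_of_nonneg_left (hle p u hu) hpt]

lemma integrable_exp_sqLength_mul {f : ℝ → ℝ} (hf : Integrable f ν) {δ : ℝ} (hδ : 0 < δ) :
    Integrable (fun a : PuncturedLattice × ℝ => Real.exp (-δ * sqLength a.1) * f a.2)
      (thetaMeasure ν) :=
  Integrable.mul_prod (integrable_count_iff.2 (summable_exp_neg_sqLength hδ).norm) hf

lemma IsAdmissible.isTempered (hw : IsAdmissible ν w) (hκ : IsSubexponential κ) :
    IsTempered (thetaMeasure ν) thetaWeight (fun a => κ a * (w a.2 : ℂ)) := by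
  have hm : AEStronglyMeasurable (fun a => κ a * (w a.2 : ℂ)) (thetaMeasure ν) :=
    hκ.measurable.aestronglyMeasurable.mul
      (Complex.continuous_ofReal.comp_aestronglyMeasurable hw.aestronglyMeasurable.comp_snd)
  refine ⟨hm, fun δ hδ => ?_⟩
  obtain ⟨c, hc, hae⟩ := hw.exists_ae_le_snd
  obtain ⟨C, hC, hκC⟩ := hκ.exists_exp_mul_norm_le hδ
  refine ((integrable_exp_sqLength_mul (hw.integrable (δ / 2 / 2) (by positivity))
    (δ := δ / 2 * c / 2) (by positivity)).const_mul C).mono' ?_ ?_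
  · exact (Real.continuous_exp.comp_aestronglyMeasurable
      (measurable_thetaWeight.const_mul _).aestronglyMeasurable).mul hm.norm
  · filter_upwards [hae] with ⟨p, t⟩ ha
    rw [norm_mul, norm_norm, norm_mul, Complex.norm_real, Real.norm_of_nonneg (Real.exp_pos _).le]
    calc Real.exp (-δ * thetaWeight (p, t)) * (‖κ (p, t)‖ * ‖w t‖)
        = Real.exp (-δ * thetaWeight (p, t)) * ‖κ (p, t)‖ * ‖w t‖ := by ring
      _ ≤ C * Real.exp (-(δ / 2) * thetaWeight (p, t)) * ‖w t‖ := by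
          exact mul_le_mul_of_nonneg_right (hκC p t (hc.trans_le ha)) (norm_nonneg _)
      _ ≤ C * (Real.exp (-(δ / 2 * c / 2) * sqLength p) * Real.exp (-(δ / 2 / 2) * t)) * ‖w t‖ := by
          gcongr
          exact exp_neg_thetaWeight_le (half_pos hδ) hc ha p
      _ = _ := by ring

lemma IsAdmissible.integrable_exp_smul (hw : IsAdmissible ν w) (hκ : IsSubexponential κ) (z : ℍ) :
    Integrable (fun a => Real.exp (thetaForm a (gram z)) • (κ a * (w a.2 : ℂ)))
      (thetaMeasure ν) :=
  hw.isControlled.integrable_exp_smul (hw.isTempered hκ) (gram_mem_posForms z)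

variable [SFinite ν]

lemma IsAdmissible.integral_lattice_ae_eq (hw : IsAdmissible ν w) (hκ : IsSubexponential κ)
    (z : ℍ) :
    (fun t => ∫ p, Real.exp (thetaForm (p, t) (gram z)) • (κ (p, t) * (w t : ℂ)) ∂Measure.count)
      =ᵐ[ν] fun t => thetaSeries κ z t * (w t : ℂ) := by
  filter_upwards [(hw.integrable_exp_smul hκ z).prod_left_ae] with t ht
  rw [integral_countable ht, thetaSeries, ← tsum_mul_right]
  exact tsum_congr fun p => by simp [Measure.real, mul_assoc]

lemma IsAdmissible.integrable_thetaSeries (hw : IsAdmissible ν w) (hκ : IsSubexponential κ)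
    (z : ℍ) : Integrable (fun t => thetaSeries κ z t * (w t : ℂ)) ν :=
  (hw.integrable_exp_smul hκ z).integral_prod_right.congr (hw.integral_lattice_ae_eq hκ z)

lemma IsAdmissible.laplaceIntegral_gram (hw : IsAdmissible ν w) (hκ : IsSubexponential κ) (z : ℍ) :
    laplaceIntegral (thetaMeasure ν) thetaForm (fun a => κ a * (w a.2 : ℂ)) (gram z) =
      thetaIntegral ν w κ z := by
  rw [laplaceIntegral, thetaMeasure, integral_prod_symm _ (hw.integrable_exp_smul hκ z)]
  exact integral_congr_ae (hw.integral_lattice_ae_eq hκ z)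

end Admissible

end ThetaSeries

section ThetaDerivatives

open MeasureTheory Filter Topology

section Coefficients

variable {κ κ' : PuncturedLattice × ℝ → ℂ}

lemma isSubexponential_const (c : ℂ) : IsSubexponential fun _ => c := by
  refine ⟨measurable_const, fun δ hδ => ⟨‖c‖, norm_nonneg _, fun p t ht => ?_⟩⟩
  exact le_mul_of_one_le_right (norm_nonneg _)
    (Real.one_le_exp (mul_nonneg hδ.le (thetaWeight_nonneg p ht.le)))

lemma IsSubexponential.add (h : IsSubexponential κ) (h' : IsSubexponential κ') :
    IsSubexponential fun a => κ a + κ' a := by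
  refine ⟨h.measurable.add h'.measurable, fun δ hδ => ?_⟩
  obtain ⟨C, hC, hκ⟩ := h.bound δ hδ
  obtain ⟨C', hC', hκ'⟩ := h'.bound δ hδ
  refine ⟨C + C', by positivity, fun p t ht => (norm_add_le _ _).trans ?_⟩
  rw [add_mul]
  exact add_le_add (hκ p t ht) (hκ' p t ht)

lemma IsSubexponential.mul (h : IsSubexponential κ) (h' : IsSubexponential κ') :
    IsSubexponential fun a => κ a * κ' a := by
  refine ⟨h.measurable.mul h'.measurable, fun δ hδ => ?_⟩
  obtain ⟨C, hC, hκ⟩ := h.bound (δ / 2) (half_pos hδ)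
  obtain ⟨C', hC', hκ'⟩ := h'.bound (δ / 2) (half_pos hδ)
  refine ⟨C * C', by positivity, fun p t ht => ?_⟩
  rw [norm_mul]
  calc _ ≤ (C * Real.exp (δ / 2 * thetaWeight (p, t))) *
        (C' * Real.exp (δ / 2 * thetaWeight (p, t))) :=
        mul_le_mul (hκ p t ht) (hκ' p t ht) (norm_nonneg _) (by positivity)
    _ = C * C' * Real.exp (δ / 2 * thetaWeight (p, t) + δ / 2 * thetaWeight (p, t)) := by
        rw [Real.exp_add]; ring
    _ = _ := by ring_nf

lemma IsSubexponential.const_mul (h : IsSubexponential κ) (c : ℂ) :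
    IsSubexponential fun a => c * κ a :=
  (isSubexponential_const c).mul h

lemma IsSubexponential.sq (h : IsSubexponential κ) : IsSubexponential fun a => κ a ^ 2 := by
  simpa only [pow_two] using h.mul h

lemma isSubexponential_thetaForm (u : ℝ × ℝ × ℝ) :
    IsSubexponential fun a => (thetaForm a u : ℂ) := by
  refine ⟨Complex.measurable_ofReal.comp ((ContinuousLinearMap.apply ℝ ℝ u).continuous
      |>.comp_stronglyMeasurable stronglyMeasurable_thetaForm).measurable, fun δ hδ => ?_⟩
  refine ⟨Real.pi * (2 * ‖u‖) / δ, by positivity, fun p t ht => ?_⟩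
  rw [Complex.norm_real, Real.norm_eq_abs, thetaForm_apply, abs_mul, abs_mul, abs_neg,
    abs_of_pos Real.pi_pos, abs_of_pos ht]
  calc Real.pi * t * |quadForm p u| ≤ Real.pi * t * (2 * ‖u‖ * sqLength p) := by
        gcongr
        exact abs_quadForm_le p u
    _ = Real.pi * (2 * ‖u‖) / δ * (δ * thetaWeight (p, t)) := by
        rw [thetaWeight]; field_simp
    _ ≤ _ := by
        gcongr
        exact (lt_add_one _).le.trans (Real.add_one_le_exp _)

end Coefficients

/-- The coefficients of the theta series obtained by applying `ξ₀`. -/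
noncomputable def xiCoeff (z : ℍ) (a : PuncturedLattice × ℝ) : ℂ :=
  Real.pi * a.2 * ((a.1.1.1 : ℂ) * conj (z : ℂ) + a.1.1.2) ^ 2 / (z.im : ℂ) ^ 2

/-- The coefficients of the theta series obtained by applying `Δ₀`. -/
noncomputable def laplacianCoeff (z : ℍ) (a : PuncturedLattice × ℝ) : ℂ :=
  thetaForm a (gram z) ^ 2 + 2 * thetaForm a (gram z)

lemma xiCoeff_eq (z : ℍ) : xiCoeff z = fun a =>
    I * (thetaForm a (gramX z) : ℂ) + (thetaForm a (gramY z) : ℂ) := by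
  funext ⟨p, t⟩
  have hy : (z.im : ℂ) ≠ 0 := by exact_mod_cast z.im_ne_zero
  have hz : conj (z : ℂ) = (z.re : ℂ) - I * z.im := by
    apply Complex.ext <;> simp
  simp only [xiCoeff, thetaForm_apply, quadForm_apply, gramX, gramY, hz, UpperHalfPlane.coe_re,
    UpperHalfPlane.coe_im]
  push_cast
  field_simp
  linear_combination (t * p.1.1 ^ 2 * z.im ^ 2 : ℂ) * Complex.I_sq

lemma isSubexponential_xiCoeff (z : ℍ) : IsSubexponential (xiCoeff z) := by
  rw [xiCoeff_eq]
  exact ((isSubexponential_thetaForm _).const_mul _).add (isSubexponential_thetaForm _)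

lemma isSubexponential_laplacianCoeff (z : ℍ) : IsSubexponential (laplacianCoeff z) :=
  (isSubexponential_thetaForm _).sq.add ((isSubexponential_thetaForm _).const_mul _)

section ThetaIntegral

variable {ν : Measure ℝ} {w : ℝ → ℝ} {κ κ' : PuncturedLattice × ℝ → ℂ}

lemma thetaIntegral_const_mul (κ : PuncturedLattice × ℝ → ℂ) (c : ℂ) (z : ℍ) :
    thetaIntegral ν w (fun a => c * κ a) z = c * thetaIntegral ν w κ z := by
  rw [thetaIntegral, thetaIntegral, ← integral_const_mul]
  refine integral_congr_ae (Eventually.of_forall fun t => ?_)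
  simp only [thetaSeries, ← tsum_mul_left, ← tsum_mul_right, Complex.real_smul]
  exact tsum_congr fun p => by ring

lemma conj_thetaIntegral_ofReal (κ : PuncturedLattice × ℝ → ℝ) (z : ℍ) :
    conj (thetaIntegral ν w (fun a => (κ a : ℂ)) z) = thetaIntegral ν w (fun a => (κ a : ℂ)) z := by
  rw [thetaIntegral, ← integral_conj]
  refine integral_congr_ae (Eventually.of_forall fun t => ?_)
  simp only [thetaSeries, map_mul, Complex.conj_tsum, Complex.real_smul, Complex.conj_ofReal]

/-- The derivative of a theta integral as a function of the coefficients of the form. -/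
noncomputable def thetaGradient (ν : Measure ℝ) (w : ℝ → ℝ) (κ : PuncturedLattice × ℝ → ℂ) :
    ℝ × ℝ × ℝ → (ℝ × ℝ × ℝ →L[ℝ] ℂ) :=
  laplaceIntegral (thetaMeasure ν) thetaForm
    (fun a => (thetaForm a).smulRight (κ a * (w a.2 : ℂ)))

lemma IsAdmissible.differentiableAt_thetaGradient (hw : IsAdmissible ν w)
    (h : IsSubexponential κ) (z : ℍ) :
    DifferentiableAt ℝ (thetaGradient ν w κ) (gram z) :=
  (hasFDerivAt_laplaceIntegral hw.isControlled ((hw.isTempered h).smulRight hw.isControlled)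
    (gram_mem_posForms z)).differentiableAt

variable [SFinite ν]

lemma IsAdmissible.thetaIntegral_add (hw : IsAdmissible ν w) (h : IsSubexponential κ)
    (h' : IsSubexponential κ') (z : ℍ) :
    thetaIntegral ν w (fun a => κ a + κ' a) z = thetaIntegral ν w κ z + thetaIntegral ν w κ' z := by
  rw [← hw.laplaceIntegral_gram h, ← hw.laplaceIntegral_gram h',
    ← hw.laplaceIntegral_gram (h.add h')]
  simp only [laplaceIntegral, add_mul, smul_add]
  exact integral_add (hw.integrable_exp_smul h z) (hw.integrable_exp_smul h' z)

lemma IsAdmissible.extend_thetaIntegral (hw : IsAdmissible ν w) (h : IsSubexponential κ) (z : ℍ) :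
    extend (thetaIntegral ν w κ) =ᶠ[𝓝 (z : ℂ)] fun x =>
      laplaceIntegral (thetaMeasure ν) thetaForm (fun a => κ a * (w a.2 : ℂ)) (gram x) := by
  filter_upwards [halfPlane_mem_nhds z] with x hx
  exact (extend_coe (thetaIntegral ν w κ) ⟨x, hx⟩).trans (hw.laplaceIntegral_gram h ⟨x, hx⟩).symm

lemma IsAdmissible.isSmooth_thetaIntegral (hw : IsAdmissible ν w) (h : IsSubexponential κ) :
    IsSmooth (thetaIntegral ν w κ) :=
  isSmooth_of_contDiffAt fun z => ContDiffAt.congr_of_eventuallyEq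
    (((contDiffOn_laplaceIntegral hw.isControlled (hw.isTempered h)).contDiffAt
      (isOpen_posForms.mem_nhds (gram_mem_posForms z))).comp (z : ℂ)
        (contDiffAt_gram z.im_ne_zero)) (hw.extend_thetaIntegral h z)

lemma IsAdmissible.thetaGradient_apply (hw : IsAdmissible ν w) (h : IsSubexponential κ) (z : ℍ)
    (u : ℝ × ℝ × ℝ) :
    thetaGradient ν w κ (gram z) u = thetaIntegral ν w (fun a => thetaForm a u * κ a) z := by
  rw [thetaGradient, laplaceIntegral_smulRight_apply hw.isControlled (hw.isTempered h)
    (gram_mem_posForms z), ← hw.laplaceIntegral_gram ((isSubexponential_thetaForm u).mul h)]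
  simp only [Complex.real_smul, mul_assoc]

lemma IsAdmissible.fderiv_thetaGradient (hw : IsAdmissible ν w) (h : IsSubexponential κ) (z : ℍ)
    (u v : ℝ × ℝ × ℝ) : fderiv ℝ (thetaGradient ν w κ) (gram z) u v =
      thetaIntegral ν w (fun a => thetaForm a v * (thetaForm a u * κ a)) z := by
  have hgrad := (hw.isTempered h).smulRight hw.isControlled
  rw [thetaGradient,
    (hasFDerivAt_laplaceIntegral hw.isControlled hgrad (gram_mem_posForms z)).fderiv,
    laplaceIntegral_smulRight_apply hw.isControlled hgrad (gram_mem_posForms z),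
    ← hw.thetaGradient_apply ((isSubexponential_thetaForm u).mul h) z v, thetaGradient]
  congr 2
  funext a
  refine ContinuousLinearMap.ext fun x => ?_
  simp only [smul_apply, ContinuousLinearMap.smulRight_apply,
    Complex.real_smul]
  ring

lemma IsAdmissible.dirDeriv_thetaIntegral (hw : IsAdmissible ν w) (h : IsSubexponential κ) (v : ℂ)
    (z : ℍ) : dirDeriv v (thetaIntegral ν w κ) z =
      thetaGradient ν w κ (gram z) (fderiv ℝ gram z v) := by
  rw [(hw.isSmooth_thetaIntegral h).dirDeriv_eq, (hw.extend_thetaIntegral h z).fderiv_eq]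
  have hlaplace :=
    hasFDerivAt_laplaceIntegral hw.isControlled (hw.isTempered h) (gram_mem_posForms z)
  have hgram := (differentiableAt_gram (w := (z : ℂ)) z.im_ne_zero).hasFDerivAt
  exact congrArg (fun L => L v) (hlaplace.comp (z : ℂ) hgram).fderiv

lemma IsAdmissible.dirDeriv_dirDeriv_thetaIntegral (hw : IsAdmissible ν w)
    (h : IsSubexponential κ) {v : ℂ} {g : ℂ → ℝ × ℝ × ℝ} (z : ℍ)
    (hg : ∀ x ∈ halfPlane, fderiv ℝ gram x v = g x) (hgz : DifferentiableAt ℝ g z) :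
    dirDeriv v (dirDeriv v (thetaIntegral ν w κ)) z = thetaIntegral ν w
      (fun a => thetaForm a (fderiv ℝ g z v) * κ a
        + thetaForm a (g z) * (thetaForm a (g z) * κ a)) z := by
  have hext : extend (dirDeriv v (thetaIntegral ν w κ)) =ᶠ[𝓝 (z : ℂ)] fun x =>
      thetaGradient ν w κ (gram x) (g x) := by
    filter_upwards [halfPlane_mem_nhds z] with x hx
    refine (extend_coe (dirDeriv v (thetaIntegral ν w κ)) ⟨x, hx⟩).trans ?_
    rw [hw.dirDeriv_thetaIntegral h, ← hg x hx]
  have hgrad := ((hw.differentiableAt_thetaGradient h z).hasFDerivAt.comp (z : ℂ)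
    (differentiableAt_gram (w := (z : ℂ)) z.im_ne_zero).hasFDerivAt).clm_apply hgz.hasFDerivAt
  have hform := isSubexponential_thetaForm
  rw [(isSmooth_dirDeriv (hw.isSmooth_thetaIntegral h) v).dirDeriv_eq, hext.fderiv_eq,
    hw.thetaIntegral_add ((hform _).mul h) ((hform _).mul ((hform _).mul h)),
    ← hw.thetaGradient_apply h, ← hw.fderiv_thetaGradient h]
  refine (congrArg (fun L => L v) hgrad.fderiv).trans ?_
  simp [hg z z.im_pos]

lemma laplacianCoeff_eq (z : ℍ) : laplacianCoeff z = fun a => (z.im : ℂ) ^ 2 *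
    (thetaForm a (fderiv ℝ gramX z 1) + thetaForm a (gramX z) ^ 2 +
      (thetaForm a (fderiv ℝ gramY z I) + thetaForm a (gramY z) ^ 2)) := by
  funext ⟨p, t⟩
  have hy : (z : ℂ).im ≠ 0 := z.im_ne_zero
  have hlin : z.im ^ 2 * (thetaForm (p, t) (fderiv ℝ gramX z 1) +
      thetaForm (p, t) (fderiv ℝ gramY z I)) = 2 * thetaForm (p, t) (gram z) := by
    rw [← map_add, fderiv_gramX_add_gramY hy, map_smul, smul_eq_mul, UpperHalfPlane.coe_im]
    field_simp
  have hquad : z.im ^ 2 * (thetaForm (p, t) (gramX z) ^ 2 + thetaForm (p, t) (gramY z) ^ 2) =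
      thetaForm (p, t) (gram z) ^ 2 := by
    simp only [thetaForm_apply]
    rw [← z.coe_im]
    linear_combination (Real.pi * t) ^ 2 * quadForm_gramX_gramY hy p
  rw [laplacianCoeff]
  norm_cast
  linear_combination -hlin - hquad

theorem IsAdmissible.laplacian_thetaIntegral (hw : IsAdmissible ν w) (z : ℍ) :
    laplacian 0 (thetaIntegral ν w fun _ => 1) z = thetaIntegral ν w (laplacianCoeff z) z := by
  have hone := isSubexponential_const 1
  have hform (u) := (isSubexponential_thetaForm u).mul hone
  have hform₂ (u v) := (hform u).add ((isSubexponential_thetaForm v).mul (hform v))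
  have hy : (z : ℂ).im ≠ 0 := z.im_ne_zero
  rw [laplacian_eq_dirDeriv, hw.dirDeriv_dirDeriv_thetaIntegral hone z
      (fun x hx => fderiv_gram_one (ne_of_gt hx)) (differentiableAt_gramX hy),
    hw.dirDeriv_dirDeriv_thetaIntegral hone z
      (fun x hx => fderiv_gram_I (ne_of_gt hx)) (differentiableAt_gramY hy),
    ← hw.thetaIntegral_add (hform₂ _ _) (hform₂ _ _), ← thetaIntegral_const_mul]
  simp only [laplacianCoeff_eq, mul_one, ← sq, Int.cast_zero, mul_zero, zero_mul, sub_zero]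

theorem IsAdmissible.xi_thetaIntegral (hw : IsAdmissible ν w) (z : ℍ) :
    xi 0 (thetaIntegral ν w fun _ => 1) z = thetaIntegral ν w (xiCoeff z) z := by
  have hone := isSubexponential_const 1
  have hform := isSubexponential_thetaForm
  have hy : (z : ℂ).im ≠ 0 := z.im_ne_zero
  rw [xi, dbar_eq_dirDeriv, hw.dirDeriv_thetaIntegral hone, hw.dirDeriv_thetaIntegral hone,
    fderiv_gram_one hy, fderiv_gram_I hy, hw.thetaGradient_apply hone, hw.thetaGradient_apply hone,
    xiCoeff_eq, hw.thetaIntegral_add ((hform _).const_mul _) (hform _), thetaIntegral_const_mul]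
  simp only [mul_one, map_mul, map_add, conj_thetaIntegral_ofReal, Complex.conj_I, map_div₀,
    map_one, map_ofNat, zpow_zero]
  linear_combination (-thetaIntegral ν w (fun a => (thetaForm a (gramY z) : ℂ)) z) * Complex.I_sq

end ThetaIntegral

end ThetaDerivatives

section FunctionalEquation

open MeasureTheory

lemma summable_of_summable_puncturedLattice {f : ℤ × ℤ → ℂ}
    (hf : Summable fun p : PuncturedLattice => f p.1) : Summable f :=
  (Set.finite_singleton ((0, 0) : ℤ × ℤ)).summable_compl_iff.1 hf

lemma tsum_eq_add_tsum_puncturedLattice {f : ℤ × ℤ → ℂ} (hf : Summable f) :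
    ∑' p, f p = f (0, 0) + ∑' p : PuncturedLattice, f p.1 := by
  rw [← hf.tsum_subtype_add_tsum_subtype_compl ({(0, 0)} : Set (ℤ × ℤ)), tsum_singleton]
  rfl

/-- The Gaussian `exp (-π t |m z + n|² / y)` on the lattice `ℤ z + ℤ`. -/
noncomputable def latticeGaussian (z : ℍ) (t : ℝ) (p : ℤ × ℤ) : ℂ :=
  Complex.exp (-Real.pi * t * (((p.1 : ℂ) * z.re + p.2) ^ 2 + (p.1 : ℂ) ^ 2 * (z.im : ℂ) ^ 2) /
    z.im)

/-- The Fourier transform of `latticeGaussian z t` in the second variable, up to the constant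
`√(y / t)`. -/
noncomputable def dualGaussian (z : ℍ) (t : ℝ) (p : ℤ × ℤ) : ℂ :=
  Complex.exp (-Real.pi * (z.im / t : ℝ) * p.2 ^ 2 - Real.pi * (t * z.im : ℝ) * p.1 ^ 2 -
    2 * Real.pi * I * z.re * p.1 * p.2)

lemma dualGaussian_inv (z : ℍ) (t : ℝ) (p : ℤ × ℤ) :
    dualGaussian z t⁻¹ p = dualGaussian z t p.swap := by
  simp only [dualGaussian, Prod.fst_swap, Prod.snd_swap]
  congr 1
  push_cast
  rw [div_inv_eq_mul]
  ring

lemma norm_dualGaussian (z : ℍ) (t : ℝ) (p : ℤ × ℤ) : ‖dualGaussian z t p‖ =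
    Real.exp (-Real.pi * (z.im / t * (p.2 : ℝ) ^ 2 + t * z.im * (p.1 : ℝ) ^ 2)) := by
  have hexponent : (-Real.pi * ((z.im / t : ℝ) : ℂ) * (p.2 : ℂ) ^ 2 -
      Real.pi * ((t * z.im : ℝ) : ℂ) * (p.1 : ℂ) ^ 2 - 2 * Real.pi * I * z.re * p.1 * p.2) =
      ((-Real.pi * (z.im / t * (p.2 : ℝ) ^ 2 + t * z.im * (p.1 : ℝ) ^ 2) : ℝ) : ℂ) +
      ((-2 * Real.pi * z.re * p.1 * p.2 : ℝ) : ℂ) * I := by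
    push_cast; ring
  rw [dualGaussian, hexponent, Complex.exp_add, norm_mul, Complex.norm_exp_ofReal_mul_I, mul_one,
    Complex.norm_exp, Complex.ofReal_re]

lemma summable_dualGaussian (z : ℍ) {t : ℝ} (ht : 0 < t) : Summable (dualGaussian z t) := by
  set c := min (z.im / t) (t * z.im)
  have hc : 0 < c := lt_min (by positivity) (by positivity)
  refine summable_of_summable_puncturedLattice
    ((summable_exp_neg_sqLength (mul_pos Real.pi_pos hc)).of_norm_bounded fun p => ?_)
  have hn := mul_le_mul_of_nonneg_right (min_le_left _ _ : c ≤ z.im / t) (sq_nonneg (p.1.2 : ℝ))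
  have hm := mul_le_mul_of_nonneg_right (min_le_right _ _ : c ≤ t * z.im) (sq_nonneg (p.1.1 : ℝ))
  rw [norm_dualGaussian, Real.exp_le_exp, sqLength]
  linarith [mul_le_mul_of_nonneg_left (add_le_add hn hm) Real.pi_pos.le]

lemma latticeGaussian_eq (z : ℍ) (t : ℝ) (p : PuncturedLattice) :
    latticeGaussian z t p.1 = Real.exp (thetaForm (p, t) (gram z)) • (1 : ℂ) := by
  have hy : (z.im : ℂ) ≠ 0 := by exact_mod_cast z.im_ne_zero
  rw [latticeGaussian, Complex.real_smul, mul_one, Complex.ofReal_exp]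
  congr 1
  simp only [thetaForm_apply, quadForm_apply, gram, UpperHalfPlane.coe_re, UpperHalfPlane.coe_im]
  push_cast
  field_simp
  ring

lemma summable_latticeGaussian (z : ℍ) {t : ℝ} (ht : 0 < t) : Summable (latticeGaussian z t) := by
  refine summable_of_summable_puncturedLattice ?_
  simp only [latticeGaussian_eq]
  exact ((isSubexponential_const 1).hasSum z ht).summable

lemma tsum_latticeGaussian (z : ℍ) {t : ℝ} (ht : 0 < t) :
    ∑' p, latticeGaussian z t p = 1 + thetaSeries (fun _ => 1) z t := by
  rw [tsum_eq_add_tsum_puncturedLattice (summable_latticeGaussian z ht), thetaSeries]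
  simp only [latticeGaussian_eq]
  simp [latticeGaussian]

lemma ofReal_cpow_half {x : ℝ} (hx : 0 ≤ x) : (x : ℂ) ^ (1 / 2 : ℂ) = (√x : ℝ) := by
  rw [Real.sqrt_eq_rpow, Complex.ofReal_cpow hx]
  norm_num

lemma tsum_latticeGaussian_right (z : ℍ) {t : ℝ} (ht : 0 < t) (m : ℤ) :
    ∑' n : ℤ, latticeGaussian z t (m, n) = (√(z.im / t) : ℝ) * ∑' n : ℤ, dualGaussian z t (m, n)
    := by
  have hy : (z.im : ℂ) ≠ 0 := by exact_mod_cast z.im_ne_zero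
  have htC : (t : ℂ) ≠ 0 := by exact_mod_cast ht.ne'
  have ha : 0 < z.im / t := div_pos z.im_pos ht
  have hsqrt : ((√(z.im / t) : ℝ) : ℂ) ≠ 0 := by exact_mod_cast (Real.sqrt_pos.2 ha).ne'
  have hpoisson := Complex.tsum_exp_neg_quadratic (a := ((z.im / t : ℝ) : ℂ)) (by simpa using ha)
    (-I * m * z.re)
  have hgauss (n : ℤ) : latticeGaussian z t (m, n) =
      Complex.exp (-Real.pi * (t * z.im : ℝ) * m ^ 2) *
      Complex.exp (-Real.pi / ((z.im / t : ℝ) : ℂ) * (n + I * (-I * m * z.re)) ^ 2) := by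
    have hshift : I * (-I * m * z.re) = m * z.re := by
      linear_combination (-(m : ℂ) * z.re) * Complex.I_mul_I
    rw [latticeGaussian, ← Complex.exp_add, hshift]
    congr 1
    push_cast
    field_simp
    ring
  have hdual (n : ℤ) : dualGaussian z t (m, n) =
      Complex.exp (-Real.pi * (t * z.im : ℝ) * m ^ 2) *
      Complex.exp (-Real.pi * ((z.im / t : ℝ) : ℂ) * n ^ 2 +
        2 * Real.pi * (-I * m * z.re) * n) := by
    rw [dualGaussian, ← Complex.exp_add]
    congr 1
    ring
  simp only [hgauss, hdual, tsum_mul_left, hpoisson, ofReal_cpow_half ha.le]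
  field_simp

lemma one_add_thetaSeries_one_eq (z : ℍ) {t : ℝ} (ht : 0 < t) :
    1 + thetaSeries (fun _ => 1) z t = (√(z.im / t) : ℝ) * ∑' p, dualGaussian z t p := by
  rw [← tsum_latticeGaussian z ht, (summable_latticeGaussian z ht).tsum_prod,
    (summable_dualGaussian z ht).tsum_prod]
  simp only [tsum_latticeGaussian_right z ht, tsum_mul_left]

theorem one_add_thetaSeries_one_inv (z : ℍ) {t : ℝ} (ht : 0 < t) :
    1 + thetaSeries (fun _ => 1) z t⁻¹ = t * (1 + thetaSeries (fun _ => 1) z t) := by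
  have hsqrt : √(z.im / t⁻¹) = t * √(z.im / t) := by
    rw [show z.im / t⁻¹ = t ^ 2 * (z.im / t) by field_simp, Real.sqrt_mul (sq_nonneg t),
      Real.sqrt_sq ht.le]
  rw [one_add_thetaSeries_one_eq z ht, one_add_thetaSeries_one_eq z (inv_pos.2 ht), hsqrt,
    ← (Equiv.prodComm ℤ ℤ).tsum_eq (dualGaussian z t), ← mul_assoc, Complex.ofReal_mul]
  exact congrArg _ (tsum_congr (dualGaussian_inv z t))

/-! For `ν` the point mass at `t` the theta integral is the theta series at `t`, so the functional
equations of the theta series with coefficients `xiCoeff` and `laplacianCoeff` follow by applying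
`ξ₀` and `Δ₀` to that of the plain theta series; the affine term `t - 1` is annihilated. -/

lemma isAdmissible_dirac {t : ℝ} (ht : 0 < t) : IsAdmissible (Measure.dirac t) fun _ => 1 :=
  ⟨⟨t, ht, by simp [ae_dirac_eq]⟩, aestronglyMeasurable_const,
    fun _ _ => integrable_dirac (by simp)⟩

lemma thetaIntegral_dirac (t : ℝ) (κ : PuncturedLattice × ℝ → ℂ) (z : ℍ) :
    thetaIntegral (Measure.dirac t) (fun _ => 1) κ z = thetaSeries κ z t := by
  simp [thetaIntegral]

lemma isSmooth_thetaIntegral_dirac {t : ℝ} (ht : 0 < t) :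
    IsSmooth (thetaIntegral (Measure.dirac t) (fun _ => 1) fun _ => 1) :=
  (isAdmissible_dirac ht).isSmooth_thetaIntegral (isSubexponential_const 1)

lemma thetaIntegral_dirac_inv {t : ℝ} (ht : 0 < t) :
    thetaIntegral (Measure.dirac t⁻¹) (fun _ => 1) (fun _ => 1) = fun z =>
      (t : ℂ) * thetaIntegral (Measure.dirac t) (fun _ => 1) (fun _ => 1) z + (t - 1) := by
  funext z
  rw [thetaIntegral_dirac, thetaIntegral_dirac]
  linear_combination one_add_thetaSeries_one_inv z ht

theorem thetaSeries_xiCoeff_inv (z : ℍ) {t : ℝ} (ht : 0 < t) :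
    thetaSeries (xiCoeff z) z t⁻¹ = t * thetaSeries (xiCoeff z) z t := by
  have hθ := isSmooth_thetaIntegral_dirac ht
  rw [← thetaIntegral_dirac, ← thetaIntegral_dirac, ← (isAdmissible_dirac ht).xi_thetaIntegral,
    ← (isAdmissible_dirac (inv_pos.2 ht)).xi_thetaIntegral, thetaIntegral_dirac_inv ht,
    xi_add (hθ.const_mul _) (isSmooth_const _), xi_const_mul hθ, xi_const, Complex.conj_ofReal,
    add_zero]

theorem thetaSeries_laplacianCoeff_inv (z : ℍ) {t : ℝ} (ht : 0 < t) :
    thetaSeries (laplacianCoeff z) z t⁻¹ = t * thetaSeries (laplacianCoeff z) z t := by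
  have hθ := isSmooth_thetaIntegral_dirac ht
  rw [← thetaIntegral_dirac, ← thetaIntegral_dirac,
    ← (isAdmissible_dirac ht).laplacian_thetaIntegral,
    ← (isAdmissible_dirac (inv_pos.2 ht)).laplacian_thetaIntegral, thetaIntegral_dirac_inv ht,
    laplacian_add (hθ.const_mul _) (isSmooth_const _), laplacian_const_mul hθ, laplacian_const,
    add_zero]

end FunctionalEquation

/-! ### Symmetrized Mellin transforms -/

section Mellin

open MeasureTheory Filter Topology Asymptotics Set

variable {f g : ℝ → ℂ}

/-- Functions on the positive half-line that are negligible at `0` and at `∞`, so that their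
Mellin transform is entire. -/
structure IsFlat (f : ℝ → ℂ) : Prop where
  locallyIntegrableOn : LocallyIntegrableOn f (Ioi 0)
  top : ∀ a : ℝ, f =O[atTop] fun t => t ^ (-a)
  bot : ∀ b : ℝ, f =O[𝓝[>] 0] fun t => t ^ (-b)

namespace IsFlat

lemma log_smul (hf : IsFlat f) : IsFlat fun t => Real.log t • f t :=
  ⟨hf.locallyIntegrableOn.continuousOn_smul isOpen_Ioi.isLocallyClosed
      (Real.continuousOn_log.mono fun _ ht => ne_of_gt ht),
    fun a => isBigO_rpow_top_log_smul (lt_add_one a) (hf.top _),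
    fun b => isBigO_rpow_zero_log_smul (sub_one_lt b) (hf.bot _)⟩

lemma log_pow_smul (hf : IsFlat f) (n : ℕ) : IsFlat fun t => Real.log t ^ n • f t := by
  induction n with
  | zero => simpa using hf
  | succ n ih => simpa only [pow_succ', mul_smul] using ih.log_smul

lemma mellinConvergent (hf : IsFlat f) (s : ℂ) : MellinConvergent f s :=
  mellinConvergent_of_isBigO_rpow hf.locallyIntegrableOn (hf.top _) (lt_add_one _) (hf.bot _)
    (sub_one_lt _)

lemma hasDerivAt_mellin (hf : IsFlat f) (s : ℂ) :
    HasDerivAt (mellin f) (mellin (fun t => Real.log t • f t) s) s :=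
  (mellin_hasDerivAt_of_isBigO_rpow hf.locallyIntegrableOn (hf.top _) (lt_add_one _) (hf.bot _)
    (sub_one_lt _)).2

lemma differentiable_mellin (hf : IsFlat f) : Differentiable ℂ (mellin f) :=
  fun s => (hf.hasDerivAt_mellin s).differentiableAt

lemma iteratedDeriv_mellin (hf : IsFlat f) (n : ℕ) :
    iteratedDeriv n (mellin f) = mellin fun t => Real.log t ^ n • f t := by
  induction n with
  | zero => simp
  | succ n ih =>
    funext s
    rw [iteratedDeriv_succ, ih, ((hf.log_pow_smul n).hasDerivAt_mellin s).deriv]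
    simp only [pow_succ', mul_smul]

end IsFlat

/-- The restriction of `g` to `t > 1`, extended by zero. -/
noncomputable def tail (g : ℝ → ℂ) : ℝ → ℂ := indicator (Ioi 1) g

lemma smul_tail (c : ℝ → ℝ) (g : ℝ → ℂ) :
    (fun t => c t • tail g t) = tail fun t => c t • g t :=
  (indicator_smul _ _ _).symm

lemma cpow_smul_tail (g : ℝ → ℂ) (s : ℂ) : (fun t : ℝ => (t : ℂ) ^ (s - 1) • tail g t) =
    indicator (Ioi 1) fun t : ℝ => (t : ℂ) ^ (s - 1) • g t :=
  (indicator_smul _ _ _).symm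

lemma mellin_tail (g : ℝ → ℂ) (s : ℂ) :
    mellin (tail g) s = ∫ t in Ioi (1 : ℝ), (t : ℂ) ^ (s - 1) • g t := by
  rw [mellin, cpow_smul_tail, setIntegral_indicator measurableSet_Ioi, Ioi_inter_Ioi,
    sup_of_le_right zero_le_one]

lemma mellinConvergent_tail_iff {s : ℂ} : MellinConvergent (tail g) s ↔
    IntegrableOn (fun t : ℝ => (t : ℂ) ^ (s - 1) • g t) (Ioi 1) := by
  rw [MellinConvergent, cpow_smul_tail, integrableOn_indicator_iff measurableSet_Ioi,
    inter_eq_left.2 (Ioi_subset_Ioi zero_le_one)]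

/-- Integrable functions with exponential decay on `t > 1`. -/
structure DecaysExponentially (g : ℝ → ℂ) : Prop where
  integrableOn : IntegrableOn g (Ioi 1)
  bound : ∃ C δ : ℝ, 0 < δ ∧ ∀ t : ℝ, 1 ≤ t → ‖g t‖ ≤ C * Real.exp (-δ * t)

lemma DecaysExponentially.isFlat_tail (hg : DecaysExponentially g) : IsFlat (tail g) where
  locallyIntegrableOn :=
    ((integrable_indicator_iff measurableSet_Ioi).2 hg.integrableOn).locallyIntegrable
      |>.locallyIntegrableOn _
  top a := by
    obtain ⟨C, δ, hδ, hle⟩ := hg.bound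
    refine IsBigO.trans (IsBigO.of_bound C ?_) (isLittleO_exp_neg_mul_rpow_atTop hδ (-a)).isBigO
    filter_upwards [eventually_gt_atTop 1] with t ht
    rw [tail, indicator_of_mem (mem_Ioi.2 ht), Real.norm_of_nonneg (Real.exp_pos _).le]
    exact hle t ht.le
  bot b := by
    refine (isBigO_zero _ _).congr' ?_ EventuallyEq.rfl
    filter_upwards [Ioo_mem_nhdsGT (zero_lt_one' ℝ)] with t ht
    rw [tail, indicator_of_notMem (notMem_Ioi.2 ht.2.le)]

/-- The symmetrized Mellin transform `∫_{t > 1} g(t) (t^s + t^{1-s}) dt/t`. -/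
noncomputable def symMellin (g : ℝ → ℂ) (s : ℂ) : ℂ := mellin (tail g) s + mellin (tail g) (1 - s)

lemma symMellin_one_sub (g : ℝ → ℂ) (s : ℂ) : symMellin g (1 - s) = symMellin g s := by
  rw [symMellin, symMellin, sub_sub_cancel, add_comm]

lemma DecaysExponentially.differentiable_symMellin (hg : DecaysExponentially g) :
    Differentiable ℂ (symMellin g) :=
  hg.isFlat_tail.differentiable_mellin.add
    (hg.isFlat_tail.differentiable_mellin.comp (differentiable_id.const_sub 1))

/-- The weights `(log t)ⁿ (t⁻¹ + (-1)ⁿ)` that compute the derivatives at `0` of the symmetrized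
Mellin transform. -/
noncomputable def logWeight (n : ℕ) (t : ℝ) : ℝ := Real.log t ^ n * (t⁻¹ + (-1) ^ n)

lemma DecaysExponentially.iteratedDeriv_symMellin_eq_mellin (hg : DecaysExponentially g) (n : ℕ) :
    iteratedDeriv n (symMellin g) 0 = mellin (fun t => Real.log t ^ n • tail g t) 0 +
      (-1) ^ n * mellin (fun t => Real.log t ^ n • tail g t) 1 := by
  have hcont : ContDiff ℂ n (mellin (tail g)) := hg.isFlat_tail.differentiable_mellin.contDiff
  have hcont' : ContDiff ℂ n fun s => mellin (tail g) (1 - s) :=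
    hcont.comp (contDiff_const.sub contDiff_id)
  rw [show symMellin g = mellin (tail g) + fun s => mellin (tail g) (1 - s) from rfl,
    iteratedDeriv_add hcont.contDiffAt hcont'.contDiffAt, iteratedDeriv_comp_const_sub,
    hg.isFlat_tail.iteratedDeriv_mellin]
  simp

lemma DecaysExponentially.iteratedDeriv_symMellin (hg : DecaysExponentially g) (n : ℕ) :
    iteratedDeriv n (symMellin g) 0 = ∫ t in Ioi (1 : ℝ), g t * (logWeight n t : ℂ) := by
  have hflat := hg.isFlat_tail.log_pow_smul n
  rw [smul_tail] at hflat
  have hint (s : ℂ) := mellinConvergent_tail_iff.1 (hflat.mellinConvergent s)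
  rw [hg.iteratedDeriv_symMellin_eq_mellin, smul_tail, mellin_tail, mellin_tail,
    ← integral_const_mul, ← integral_add (hint 0) ((hint 1).const_mul _)]
  refine setIntegral_congr_fun measurableSet_Ioi fun t _ => ?_
  simp [logWeight, Complex.cpow_neg_one]
  ring

/-- The functional equation `φ(1/t) = t φ(t)` of a theta series `φ = g + g₀` of weight `1` with
constant term `g₀`. -/
def IsTheta (g : ℝ → ℂ) (g₀ : ℂ) : Prop := ∀ t : ℝ, 0 < t → g t⁻¹ + g₀ = t * (g t + g₀)

variable {g₀ s : ℂ}

lemma IsTheta.eq_tail_add (h : IsTheta g g₀) {t : ℝ} (ht : 0 < t) (ht1 : t ≠ 1) :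
    g t = tail g t + (t : ℂ) ^ (-1 : ℂ) • tail g t⁻¹ +
      g₀ • (indicator (Ioc 0 1) (fun t : ℝ => (t : ℂ) ^ (-1 : ℂ)) t -
        indicator (Ioc 0 1) (fun _ => 1) t) := by
  have htC : (t : ℂ) ≠ 0 := by exact_mod_cast ht.ne'
  rcases lt_or_gt_of_ne ht1 with hlt | hgt
  · have hmem : t ∈ Ioc (0 : ℝ) 1 := ⟨ht, hlt.le⟩
    rw [tail, indicator_of_notMem (notMem_Ioi.2 hlt.le),
      indicator_of_mem (mem_Ioi.2 ((one_lt_inv₀ ht).2 hlt)), indicator_of_mem hmem,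
      indicator_of_mem hmem, Complex.cpow_neg_one, smul_eq_mul, smul_eq_mul,
      eq_sub_of_add_eq (h t ht)]
    field_simp
    ring
  · have hmem : t ∉ Ioc (0 : ℝ) 1 := fun ht' => ht'.2.not_gt hgt
    rw [tail, indicator_of_mem (mem_Ioi.2 hgt),
      indicator_of_notMem (notMem_Ioi.2 (inv_lt_one_of_one_lt₀ hgt).le), indicator_of_notMem hmem,
      indicator_of_notMem hmem]
    simp

lemma hasMellin_cpow_neg_one_smul_comp_inv (hf : MellinConvergent f (1 - s)) :
    HasMellin (fun t : ℝ => (t : ℂ) ^ (-1 : ℂ) • f t⁻¹) s (mellin f (1 - s)) := by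
  have hs : -(s + -1) = 1 - s := by ring
  refine ⟨?_, by rw [mellin_cpow_smul, mellin_comp_inv, hs]⟩
  have hinv := MellinConvergent.comp_rpow (f := f) (s := s + -1) (a := -1) (by norm_num)
  simp only [Real.rpow_neg_one, Complex.ofReal_neg, Complex.ofReal_one, div_neg, div_one, hs]
    at hinv
  exact MellinConvergent.cpow_smul.2 (hinv.2 hf)

lemma hasMellin_cpow_neg_one_sub_one_Ioc (hs : 1 < s.re) :
    HasMellin (fun t => indicator (Ioc 0 1) (fun t : ℝ => (t : ℂ) ^ (-1 : ℂ)) t -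
      indicator (Ioc 0 1) (fun _ => 1) t) s (1 / (s * (s - 1))) := by
  have hs0 : s ≠ 0 := Complex.ne_zero_of_re_pos (zero_lt_one.trans hs)
  have hs1 : s + -1 ≠ 0 := Complex.ne_zero_of_re_pos (by simpa using hs)
  have hone := hasMellin_one_Ioc (s := s) (by linarith)
  have hinv := hasMellin_cpow_Ioc (-1) (s := s) (by simpa using hs)
  have hsub := hasMellin_sub hinv.1 hone.1
  rw [hone.2, hinv.2] at hsub
  have hval : 1 / (s * (s - 1)) = 1 / (s + -1) - 1 / s := by
    rw [sub_eq_add_neg s 1]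
    field_simp
    ring
  rwa [hval]

lemma DecaysExponentially.mellin_eq_symMellin (hg : DecaysExponentially g) (h : IsTheta g g₀)
    (hs : 1 < s.re) : mellin g s = symMellin g s + g₀ / (s * (s - 1)) := by
  have hflat := hg.isFlat_tail
  have hinv := hasMellin_cpow_neg_one_smul_comp_inv (hflat.mellinConvergent (1 - s))
  have hIoc := hasMellin_cpow_neg_one_sub_one_Ioc hs
  have hconst := hasMellin_const_smul hIoc.1 g₀
  have hsym := hasMellin_add (hflat.mellinConvergent s) hinv.1
  have hsum := (hasMellin_add hsym.1 hconst.1).2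
  rw [hsym.2, hconst.2, hIoc.2, hinv.2, smul_eq_mul, mul_one_div] at hsum
  rw [symMellin, ← hsum, mellin, mellin]
  refine setIntegral_congr_ae measurableSet_Ioi ?_
  filter_upwards [Measure.ae_ne volume 1] with t ht1 ht
  exact congrArg _ (h.eq_tail_add ht ht1)

lemma integral_rpow_mul_norm_comp_mul_left (f : ℝ → ℂ) (σ : ℝ) {q : ℝ} (hq : 0 < q) :
    ∫ t in Ioi (0 : ℝ), t ^ (σ - 1) * ‖f (q * t)‖ =
      q ^ (-σ) * ∫ t in Ioi (0 : ℝ), t ^ (σ - 1) * ‖f t‖ := by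
  have hscale := integral_comp_mul_left_Ioi (fun t => t ^ (σ - 1) * ‖f t‖) 0 hq
  rw [mul_zero, smul_eq_mul] at hscale
  rw [← (eq_inv_mul_iff_mul_eq₀ hq.ne').1 hscale, ← mul_assoc, ← Real.rpow_add_one hq.ne',
    ← integral_const_mul]
  refine setIntegral_congr_fun measurableSet_Ioi fun t ht => ?_
  rw [Real.mul_rpow hq.le (le_of_lt ht), ← mul_assoc, ← mul_assoc, ← Real.rpow_add hq]
  simp

lemma mellin_const_mul_comp_mul_left (f : ℝ → ℂ) (s a : ℂ) {q : ℝ} (hq : 0 < q) :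
    mellin (fun t => a * f (q * t)) s = mellin f s * (a * (q : ℂ) ^ (-s)) := by
  have hsmul := mellin_const_smul (fun t => f (q * t)) s a
  simp only [mellin_comp_mul_left f s hq, smul_eq_mul] at hsmul
  rw [hsmul]
  ring

lemma integral_norm_mellin_dilate (f : ℝ → ℂ) (s a : ℂ) {q : ℝ} (hq : 0 < q) :
    ∫ t in Ioi (0 : ℝ), ‖(t : ℂ) ^ (s - 1) • (a * f (q * t))‖ =
      ‖a‖ * q ^ (-s.re) * ∫ t in Ioi (0 : ℝ), t ^ (s.re - 1) * ‖f t‖ := by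
  rw [mul_assoc, ← integral_rpow_mul_norm_comp_mul_left f s.re hq, ← integral_const_mul]
  refine setIntegral_congr_fun measurableSet_Ioi fun t ht => ?_
  simp only [norm_smul, norm_mul, Complex.norm_cpow_eq_rpow_re_of_pos (mem_Ioi.1 ht),
    Complex.sub_re, Complex.one_re]
  ring

lemma mellin_tsum_dilate {ι : Type*} [Countable ι] (hf : MellinConvergent f s)
    {a : ι → ℂ} {q : ι → ℝ} (hq : ∀ i, 0 < q i) (hs : Summable fun i => ‖a i‖ * q i ^ (-s.re)) :
    mellin (fun t => ∑' i, a i * f (q i * t)) s = mellin f s * ∑' i, a i * (q i : ℂ) ^ (-s) := by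
  have hint (i) : IntegrableOn (fun t : ℝ => (t : ℂ) ^ (s - 1) • (a i * f (q i * t))) (Ioi 0) :=
    ((MellinConvergent.comp_mul_left (hq i)).2 hf).const_smul (a i)
  have hnorm : Summable fun i =>
      ∫ t in Ioi (0 : ℝ), ‖(t : ℂ) ^ (s - 1) • (a i * f (q i * t))‖ := by
    simpa only [integral_norm_mellin_dilate f s _ (hq _)] using hs.mul_right _
  rw [← tsum_mul_left, mellin]
  simp only [← mellin_const_mul_comp_mul_left f s _ (hq _), smul_eq_mul, ← tsum_mul_left]
  exact (hasSum_integral_of_summable_integral_norm hint hnorm).tsum_eq.symm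

end Mellin

section MellinCoefficients

open MeasureTheory Filter Topology Asymptotics Set

lemma isAdmissible_of_le_pow {w : ℝ → ℝ} (hw : ContinuousOn w (Ici 1)) {C : ℝ} {n : ℕ}
    (hC : ∀ t : ℝ, 1 ≤ t → |w t| ≤ C * t ^ n) : IsAdmissible (volume.restrict (Ioi 1)) w := by
  refine ⟨⟨1, one_pos, (ae_restrict_mem measurableSet_Ioi).mono fun t ht => le_of_lt ht⟩,
    (hw.mono Ioi_subset_Ici_self).aestronglyMeasurable measurableSet_Ioi, fun δ hδ => ?_⟩
  refine integrable_of_isBigO_exp_neg (b := δ / 2) (half_pos hδ)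
    ((by fun_prop : Continuous fun t : ℝ => Real.exp (-δ * t)).continuousOn.mul hw.norm) ?_
  have hwpow : (fun t => ‖w t‖) =O[atTop] fun t : ℝ => t ^ n := by
    refine IsBigO.of_bound C ?_
    filter_upwards [eventually_ge_atTop 1] with t ht
    rw [norm_norm, Real.norm_of_nonneg (pow_nonneg (zero_le_one.trans ht) n)]
    exact hC t ht
  have hwexp : (fun t => ‖w t‖) =O[atTop] fun t => Real.exp (δ / 2 * t) :=
    hwpow.trans (isLittleO_pow_exp_pos_mul_atTop n (half_pos hδ)).isBigO
  refine ((isBigO_refl _ atTop).mul hwexp).congr_right fun t => ?_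
  rw [← Real.exp_add]
  ring_nf

lemma isAdmissible_logWeight (n : ℕ) : IsAdmissible (volume.restrict (Ioi 1)) (logWeight n) := by
  refine isAdmissible_of_le_pow (C := 2) (n := n) ?_ fun t ht => ?_
  · have hne (t) (ht : t ∈ Ici (1 : ℝ)) : t ≠ 0 := (zero_lt_one.trans_le ht).ne'
    exact ((continuousOn_id.log hne).pow n).mul ((continuousOn_id.inv₀ hne).add continuousOn_const)
  · have hlog : 0 ≤ Real.log t := Real.log_nonneg ht
    have hlog_le : Real.log t ≤ t := Real.log_le_self (zero_le_one.trans ht)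
    have hsum : |t⁻¹ + (-1) ^ n| ≤ 2 := by
      refine (abs_add_le _ _).trans ?_
      rw [abs_pow, abs_neg, abs_one, one_pow, abs_of_pos (by positivity)]
      linarith [inv_le_one_of_one_le₀ ht]
    rw [logWeight, abs_mul, abs_pow, abs_of_nonneg hlog, mul_comm]
    gcongr

lemma IsSubexponential.decaysExponentially {κ : PuncturedLattice × ℝ → ℂ}
    (hκ : IsSubexponential κ) (z : ℍ) : DecaysExponentially (thetaSeries κ z) := by
  refine ⟨?_, hκ.exists_norm_thetaSeries_le z⟩
  have hone : IsAdmissible (volume.restrict (Ioi 1)) fun _ => 1 :=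
    isAdmissible_of_le_pow (C := 1) (n := 0) continuousOn_const fun t _ => by simp
  simpa only [IntegrableOn, Complex.ofReal_one, mul_one] using hone.integrable_thetaSeries hκ z

/-- The coefficient of `sⁿ` in the Taylor expansion at `0` of an entire function. -/
noncomputable def taylorAt (n : ℕ) (f : ℂ → ℂ) : ℂ := iteratedDeriv n f 0 / (n ! : ℂ)

/-- The Taylor coefficients at `0` of the symmetrized Mellin transform of a theta series. -/
noncomputable def mellinCoeff (κ : PuncturedLattice × ℝ → ℂ) (n : ℕ) (z : ℍ) : ℂ :=
  taylorAt n (symMellin (thetaSeries κ z))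

lemma IsSubexponential.mellinCoeff_eq {κ : PuncturedLattice × ℝ → ℂ} (hκ : IsSubexponential κ)
    (n : ℕ) (z : ℍ) : mellinCoeff κ n z =
      (n ! : ℂ)⁻¹ * thetaIntegral (volume.restrict (Ioi 1)) (logWeight n) κ z := by
  rw [mellinCoeff, taylorAt, (hκ.decaysExponentially z).iteratedDeriv_symMellin, thetaIntegral,
    div_eq_inv_mul]

lemma mellinCoeff_one_eq (n : ℕ) : mellinCoeff (fun _ => 1) n = fun z =>
    (n ! : ℂ)⁻¹ * thetaIntegral (volume.restrict (Ioi 1)) (logWeight n) (fun _ => 1) z :=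
  funext ((isSubexponential_const 1).mellinCoeff_eq n)

lemma isSmooth_thetaIntegral_logWeight (n : ℕ) :
    IsSmooth (thetaIntegral (volume.restrict (Ioi 1)) (logWeight n) fun _ => 1) :=
  (isAdmissible_logWeight n).isSmooth_thetaIntegral (isSubexponential_const 1)

lemma isSmooth_mellinCoeff (n : ℕ) : IsSmooth (mellinCoeff (fun _ => 1) n) := by
  rw [mellinCoeff_one_eq]
  exact (isSmooth_thetaIntegral_logWeight n).const_mul _

lemma xi_mellinCoeff (n : ℕ) (z : ℍ) :
    xi 0 (mellinCoeff (fun _ => 1) n) z = mellinCoeff (xiCoeff z) n z := by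
  rw [mellinCoeff_one_eq, xi_const_mul (isSmooth_thetaIntegral_logWeight n),
    (isAdmissible_logWeight n).xi_thetaIntegral, (isSubexponential_xiCoeff z).mellinCoeff_eq,
    map_inv₀, map_natCast]

lemma laplacian_mellinCoeff (n : ℕ) (z : ℍ) :
    laplacian 0 (mellinCoeff (fun _ => 1) n) z = mellinCoeff (laplacianCoeff z) n z := by
  rw [mellinCoeff_one_eq, laplacian_const_mul (isSmooth_thetaIntegral_logWeight n),
    (isAdmissible_logWeight n).laplacian_thetaIntegral,
    (isSubexponential_laplacianCoeff z).mellinCoeff_eq]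

end MellinCoefficients

/-! ### Mellin transforms of theta series -/

section MellinTheta

lemma quadForm_gram_pos (z : ℍ) (p : PuncturedLattice) : 0 < quadForm p (gram z) := by
  obtain ⟨ε, hε, hle⟩ := gram_mem_posForms z
  exact (mul_pos hε (sqLength_pos p)).trans_le (hle p)

lemma lattice_ne_zero (z : ℍ) (p : PuncturedLattice) : (p.1.1 : ℂ) * z + p.1.2 ≠ 0 := fun h => by
  simpa [quadForm_gram, h] using quadForm_gram_pos z p

lemma ofReal_quadForm_gram (z : ℍ) (p : PuncturedLattice) : (quadForm p (gram z) : ℂ) =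
    ((p.1.1 : ℂ) * z + p.1.2) * conj ((p.1.1 : ℂ) * z + p.1.2) / z.im := by
  rw [Complex.mul_conj, Complex.normSq_eq_norm_sq, quadForm_gram, Complex.ofReal_div]

lemma summable_quadForm_rpow (z : ℍ) {σ : ℝ} (hσ : 1 < σ) :
    Summable fun p : PuncturedLattice => quadForm p (gram z) ^ (-σ) := by
  obtain ⟨ε, hε, hle⟩ := gram_mem_posForms z
  refine ((summable_sqLength_rpow hσ).mul_left (ε ^ (-σ))).of_nonneg_of_le
    (fun p => Real.rpow_nonneg (quadForm_gram_pos z p).le _) fun p => ?_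
  have hp := sqLength_pos p
  rw [← Real.mul_rpow hε.le hp.le]
  exact Real.rpow_le_rpow_of_nonpos (by positivity) (hle p) (by linarith)

lemma hasMellin_exp_neg_pi {s : ℂ} (hs : 0 < s.re) :
    HasMellin (fun t : ℝ => (Real.exp (-(Real.pi * t)) : ℂ)) s
      ((Real.pi : ℂ) ^ (-s) * Complex.Gamma s) := by
  have hconv : MellinConvergent (fun t : ℝ => (Real.exp (-t) : ℂ)) s := by
    simpa only [MellinConvergent, smul_eq_mul, mul_comm] using Complex.GammaIntegral_convergent hs
  refine ⟨(MellinConvergent.comp_mul_left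
    (f := fun t : ℝ => (Real.exp (-t) : ℂ)) Real.pi_pos).2 hconv, ?_⟩
  rw [mellin_comp_mul_left (fun t : ℝ => (Real.exp (-t) : ℂ)) s Real.pi_pos,
    Complex.Gamma_eq_integral hs, Complex.GammaIntegral_eq_mellin, smul_eq_mul]

lemma hasMellin_pow_mul_exp_neg_pi {s : ℂ} (hs : 0 < s.re) (n : ℕ) :
    HasMellin (fun t : ℝ => (Real.pi * t : ℂ) ^ n * (Real.exp (-(Real.pi * t)) : ℂ)) s
      ((Real.pi : ℂ) ^ (-s) * Complex.Gamma (s + n)) := by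
  have hpi : (Real.pi : ℂ) ≠ 0 := by exact_mod_cast Real.pi_ne_zero
  have hexp := hasMellin_exp_neg_pi (s := s + n)
    (by rw [Complex.add_re, Complex.natCast_re]; positivity)
  have hpow := hasMellin_const_smul (MellinConvergent.cpow_smul.2 hexp.1) ((Real.pi : ℂ) ^ n)
  rw [mellin_cpow_smul, hexp.2] at hpow
  convert hpow using 1
  · funext t
    simp only [smul_eq_mul, Complex.cpow_natCast]
    ring
  · rw [neg_add, Complex.cpow_add _ _ hpi, Complex.cpow_neg _ (n : ℂ), Complex.cpow_natCast,
      smul_eq_mul]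
    field_simp

lemma mellin_thetaSeries (z : ℍ) {κ : PuncturedLattice × ℝ → ℂ} {a : PuncturedLattice → ℂ}
    {f : ℝ → ℂ} {C : ℝ} {s A : ℂ} (hκ : ∀ p t, κ (p, t) = a p * f (quadForm p (gram z) * t))
    (ha : ∀ p, ‖a p‖ ≤ C) (hs : 1 < s.re)
    (hf : HasMellin (fun t => f t * (Real.exp (-(Real.pi * t)) : ℂ)) s A) :
    mellin (thetaSeries κ z) s = A * ∑' p, a p * (quadForm p (gram z) : ℂ) ^ (-s) := by
  have hsum := summable_quadForm_rpow z hs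
  have htheta : thetaSeries κ z = fun t => ∑' p, a p * (f (quadForm p (gram z) * t) *
      (Real.exp (-(Real.pi * (quadForm p (gram z) * t))) : ℂ)) := by
    funext t
    refine tsum_congr fun p => ?_
    rw [hκ, thetaForm_apply, Complex.real_smul,
      show -Real.pi * t * quadForm p (gram z) = -(Real.pi * (quadForm p (gram z) * t)) by ring]
    ring
  rw [htheta, ← hf.2]
  refine mellin_tsum_dilate hf.1 (quadForm_gram_pos z) ((hsum.mul_left C).of_nonneg_of_le ?_ ?_)
  · exact fun p => mul_nonneg (norm_nonneg _) (Real.rpow_nonneg (quadForm_gram_pos z p).le _)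
  · exact fun p =>
      mul_le_mul_of_nonneg_right (ha p) (Real.rpow_nonneg (quadForm_gram_pos z p).le _)

/-- The Epstein zeta function of the quadratic form attached to `z`. -/
noncomputable def epstein (z : ℍ) (s : ℂ) : ℂ :=
  ∑' p : PuncturedLattice, (quadForm p (gram z) : ℂ) ^ (-s)

lemma mellin_thetaSeries_one (z : ℍ) {s : ℂ} (hs : 1 < s.re) :
    mellin (thetaSeries (fun _ => 1) z) s =
      (Real.pi : ℂ) ^ (-s) * Complex.Gamma s * epstein z s := by
  rw [mellin_thetaSeries z (a := fun _ => 1) (f := fun _ => 1) (fun _ _ => (mul_one 1).symm)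
    (fun _ => norm_one.le) hs
    (by simpa only [one_mul] using hasMellin_exp_neg_pi (zero_lt_one.trans hs)), epstein]
  simp only [one_mul]

lemma hasMellin_quadratic_mul_exp_neg_pi {s : ℂ} (hs : 0 < s.re) :
    HasMellin (fun t : ℝ => ((Real.pi * t : ℂ) ^ 2 - 2 * (Real.pi * t : ℂ)) *
      (Real.exp (-(Real.pi * t)) : ℂ)) s
      (s * (s - 1) * ((Real.pi : ℂ) ^ (-s) * Complex.Gamma s)) := by
  have hlin := hasMellin_pow_mul_exp_neg_pi hs 1
  have hsmul := hasMellin_const_smul hlin.1 (2 : ℂ)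
  have hquad := hasMellin_pow_mul_exp_neg_pi hs 2
  have hsub := hasMellin_sub hquad.1 hsmul.1
  rw [hsmul.2, hquad.2, hlin.2] at hsub
  have hs1 : s + 1 ≠ 0 := Complex.ne_zero_of_re_pos (by
    rw [Complex.add_re, Complex.one_re]
    positivity)
  have hgamma₁ : Complex.Gamma (s + (1 : ℕ)) = s * Complex.Gamma s := by
    rw [Nat.cast_one, Complex.Gamma_add_one s (Complex.ne_zero_of_re_pos hs)]
  have hgamma₂ : Complex.Gamma (s + (2 : ℕ)) = (s + 1) * (s * Complex.Gamma s) := by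
    rw [← hgamma₁, Nat.cast_one, ← Complex.Gamma_add_one (s + 1) hs1, add_assoc,
      one_add_one_eq_two, Nat.cast_ofNat]
  convert hsub using 1
  · funext t
    rw [smul_eq_mul]
    ring
  · rw [hgamma₁, hgamma₂, smul_eq_mul]
    ring

lemma mellin_thetaSeries_laplacianCoeff (z : ℍ) {s : ℂ} (hs : 1 < s.re) :
    mellin (thetaSeries (laplacianCoeff z) z) s =
      s * (s - 1) * ((Real.pi : ℂ) ^ (-s) * Complex.Gamma s * epstein z s) := by
  have hcoeff (p t) : laplacianCoeff z (p, t) =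
      1 * ((Real.pi * (quadForm p (gram z) * t : ℝ) : ℂ) ^ 2 -
        2 * (Real.pi * (quadForm p (gram z) * t : ℝ) : ℂ)) := by
    rw [laplacianCoeff, thetaForm_apply]
    push_cast
    ring
  rw [mellin_thetaSeries z (a := fun _ => 1)
    (f := fun t => (Real.pi * t : ℂ) ^ 2 - 2 * (Real.pi * t : ℂ)) hcoeff (fun _ => norm_one.le) hs
    (hasMellin_quadratic_mul_exp_neg_pi (zero_lt_one.trans hs)), epstein]
  simp only [one_mul, mul_assoc]

/-- The factor by which the term of `p = (m, n)` in the weight `2` series differs from that in the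
weight `0` series at `s + 1`. -/
noncomputable def phase (z : ℍ) (p : PuncturedLattice) : ℂ :=
  conj ((p.1.1 : ℂ) * z + p.1.2) / (((p.1.1 : ℂ) * z + p.1.2) * z.im)

lemma norm_phase (z : ℍ) (p : PuncturedLattice) : ‖phase z p‖ = 1 / z.im := by
  have hw : ‖(p.1.1 : ℂ) * z + p.1.2‖ ≠ 0 := norm_ne_zero_iff.2 (lattice_ne_zero z p)
  rw [phase, norm_div, Complex.norm_conj, norm_mul, Complex.norm_real,
    Real.norm_of_nonneg z.im_pos.le, div_mul_eq_div_div, div_self hw]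

lemma xiCoeff_eq_phase_mul (z : ℍ) (p : PuncturedLattice) (t : ℝ) :
    xiCoeff z (p, t) = phase z p * (Real.pi * (quadForm p (gram z) * t : ℝ)) ^ 1 := by
  have hw := lattice_ne_zero z p
  have hconj : (p.1.1 : ℂ) * conj (z : ℂ) + p.1.2 = conj ((p.1.1 : ℂ) * z + p.1.2) := by simp
  rw [xiCoeff, phase, Complex.ofReal_mul, ofReal_quadForm_gram, hconj]
  field_simp

lemma mellin_thetaSeries_xiCoeff (z : ℍ) {s : ℂ} (hs : 1 < s.re) :
    mellin (thetaSeries (xiCoeff z) z) s = (Real.pi : ℂ) ^ (-s) * Complex.Gamma (s + 1) *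
      ∑' p, phase z p * (quadForm p (gram z) : ℂ) ^ (-s) := by
  rw [mellin_thetaSeries z (f := fun t => (Real.pi * t : ℂ) ^ 1) (xiCoeff_eq_phase_mul z)
    (fun p => (norm_phase z p).le) hs (hasMellin_pow_mul_exp_neg_pi (zero_lt_one.trans hs) 1),
    Nat.cast_one]

lemma quadForm_cpow_neg (z : ℍ) (p : PuncturedLattice) (s : ℂ) :
    (quadForm p (gram z) : ℂ) ^ (-s) =
      (z.im : ℂ) ^ s / ((‖(p.1.1 : ℂ) * z + p.1.2‖ : ℝ) : ℂ) ^ (2 * s) := by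
  have hnorm : 0 < ‖(p.1.1 : ℂ) * z + p.1.2‖ := norm_pos_iff.2 (lattice_ne_zero z p)
  have hy := z.im_pos
  have hq := quadForm_gram_pos z p
  rw [Complex.cpow_def_of_ne_zero (by exact_mod_cast hq.ne'),
    Complex.cpow_def_of_ne_zero (by exact_mod_cast hy.ne'),
    Complex.cpow_def_of_ne_zero (by exact_mod_cast hnorm.ne'), ← Complex.ofReal_log hq.le,
    ← Complex.ofReal_log hnorm.le, ← Complex.ofReal_log hy.le, ← Complex.exp_sub, quadForm_gram,
    Real.log_div (by positivity) hy.ne', Real.log_pow]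
  congr 1
  push_cast
  ring

lemma eisensteinSeries_zero (z : ℍ) (s : ℂ) : eisensteinSeries 0 z s = 1 / 2 * epstein z s := by
  rw [eisensteinSeries, epstein]
  congr 1
  refine tsum_congr fun p => ?_
  rw [zpow_zero, one_mul, quadForm_cpow_neg]

lemma eisensteinSeries_two (z : ℍ) (s : ℂ) : eisensteinSeries 2 z s =
    1 / 2 * ∑' p, phase z p * (quadForm p (gram z) : ℂ) ^ (-(s + 1)) := by
  rw [eisensteinSeries]
  congr 1
  refine tsum_congr fun p => ?_
  have hw := lattice_ne_zero z p
  have hw' : conj ((p.1.1 : ℂ) * z + p.1.2) ≠ 0 := (map_ne_zero _).2 hw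
  have hy : (z.im : ℂ) ≠ 0 := by exact_mod_cast z.im_ne_zero
  have hq : (quadForm p (gram z) : ℂ) ≠ 0 := by exact_mod_cast (quadForm_gram_pos z p).ne'
  rw [neg_add, Complex.cpow_add _ _ hq, Complex.cpow_neg_one, quadForm_cpow_neg,
    ofReal_quadForm_gram, phase, zpow_ofNat]
  field_simp

end MellinTheta

/-! ### Taylor coefficients of the completed Eisenstein series -/

section Taylor

lemma entire_eq_of_eq_on_halfPlane {f g : ℂ → ℂ} (hf : Differentiable ℂ f) (hg : Differentiable ℂ g)
    {c : ℝ} (h : ∀ s : ℂ, c < s.re → f s = g s) : f = g := by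
  have hopen : IsOpen {s : ℂ | c < s.re} := isOpen_lt continuous_const Complex.continuous_re
  have hmem : {s : ℂ | c < s.re} ∈ nhds ((c + 1 : ℝ) : ℂ) := hopen.mem_nhds (by simp)
  exact AnalyticOnNhd.eq_of_eventuallyEq (fun s _ => hf.analyticAt s) (fun s _ => hg.analyticAt s)
    (Filter.mem_of_superset hmem h)

lemma taylorAt_sub {f g : ℂ → ℂ} (hf : Differentiable ℂ f) (hg : Differentiable ℂ g) (n : ℕ) :
    taylorAt n (fun s => f s - g s) = taylorAt n f - taylorAt n g := by
  rw [taylorAt, taylorAt, taylorAt, ← sub_div,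
    iteratedDeriv_fun_sub hf.contDiff.contDiffAt hg.contDiff.contDiffAt]

lemma taylorAt_const_mul (f : ℂ → ℂ) (c : ℂ) (n : ℕ) :
    taylorAt n (fun s => c * f s) = c * taylorAt n f := by
  rw [taylorAt, taylorAt, iteratedDeriv_const_mul_field, mul_div_assoc]

lemma taylorAt_comp_neg (f : ℂ → ℂ) (n : ℕ) :
    taylorAt n (fun s => f (-s)) = (-1) ^ n * taylorAt n f := by
  rw [taylorAt, taylorAt, iteratedDeriv_comp_neg, neg_zero, smul_eq_mul, mul_div_assoc]

lemma taylorAt_zero_id_mul (f : ℂ → ℂ) : taylorAt 0 (fun s => s * f s) = 0 := by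
  simp [taylorAt]

lemma taylorAt_succ_id_mul {f : ℂ → ℂ} (hf : Differentiable ℂ f) (n : ℕ) :
    taylorAt (n + 1) (fun s => s * f s) = taylorAt n f := by
  have hleibniz : iteratedDeriv (n + 1) (fun s => s * f s) 0 = (n + 1) * iteratedDeriv n f 0 := by
    rw [iteratedDeriv_fun_mul contDiffAt_fun_id hf.contDiff.contDiffAt,
      Finset.sum_eq_single_of_mem 1 (by simp) fun i _ hi => by
        rw [iteratedDeriv_fun_id_zero, if_neg hi, mul_zero, zero_mul]]
    simp [iteratedDeriv_fun_id_zero]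
  have hn : (n : ℂ) + 1 ≠ 0 := by exact_mod_cast n.succ_ne_zero
  rw [taylorAt, taylorAt, hleibniz, Nat.factorial_succ, Nat.cast_mul, Nat.cast_succ,
    mul_div_mul_left _ _ hn]

variable {f : ℂ → ℂ}

lemma taylorAt_mul_sub_one_mul (hf : Differentiable ℂ f) (n : ℕ) :
    taylorAt n (fun s => s * (s - 1) * f s) =
      taylorAt n (fun s => s * (s * f s)) - taylorAt n (fun s => s * f s) := by
  rw [← taylorAt_sub (by fun_prop) (by fun_prop)]
  congr 1
  funext s
  ring

lemma taylorAt_zero_mul_sub_one_mul (hf : Differentiable ℂ f) :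
    taylorAt 0 (fun s => s * (s - 1) * f s) = 0 := by
  rw [taylorAt_mul_sub_one_mul hf, taylorAt_zero_id_mul, taylorAt_zero_id_mul, sub_zero]

lemma taylorAt_one_mul_sub_one_mul (hf : Differentiable ℂ f) :
    taylorAt 1 (fun s => s * (s - 1) * f s) = -taylorAt 0 f := by
  rw [taylorAt_mul_sub_one_mul hf, taylorAt_succ_id_mul (by fun_prop), taylorAt_zero_id_mul,
    taylorAt_succ_id_mul hf, zero_sub]

lemma taylorAt_add_two_mul_sub_one_mul (hf : Differentiable ℂ f) (n : ℕ) :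
    taylorAt (n + 2) (fun s => s * (s - 1) * f s) = taylorAt n f - taylorAt (n + 1) f := by
  rw [taylorAt_mul_sub_one_mul hf, taylorAt_succ_id_mul (by fun_prop), taylorAt_succ_id_mul hf,
    taylorAt_succ_id_mul hf]

end Taylor

section Completed

/-- The entire continuation of the doubly completed weight `0` Eisenstein series. -/
noncomputable def completedZero (z : ℍ) (s : ℂ) : ℂ :=
  1 / 2 + 1 / 2 * (s * (s - 1) * symMellin (thetaSeries (fun _ => 1) z) s)

/-- The entire continuation of the doubly completed weight `2` Eisenstein series. It is written as
a function of `-s` because its functional equation is `s ↦ -s`. -/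
noncomputable def completedTwo (z : ℍ) (s : ℂ) : ℂ :=
  1 / 2 * (-s * (-s - 1) * symMellin (thetaSeries (xiCoeff z) z) (-s))

lemma differentiable_symMellin_one (z : ℍ) :
    Differentiable ℂ (symMellin (thetaSeries (fun _ => 1) z)) :=
  ((isSubexponential_const 1).decaysExponentially z).differentiable_symMellin

lemma differentiable_symMellin_xiCoeff (z : ℍ) :
    Differentiable ℂ (symMellin (thetaSeries (xiCoeff z) z)) :=
  ((isSubexponential_xiCoeff z).decaysExponentially z).differentiable_symMellin

lemma differentiable_completedZero (z : ℍ) : Differentiable ℂ (completedZero z) := by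
  have hΛ := differentiable_symMellin_one z
  unfold completedZero
  fun_prop

lemma differentiable_completedTwo (z : ℍ) : Differentiable ℂ (completedTwo z) := by
  have hΛ := differentiable_symMellin_xiCoeff z
  unfold completedTwo
  fun_prop

lemma completedZero_eq (z : ℍ) {s : ℂ} (hs : 1 < s.re) : completedZero z s =
    s * (s - 1) * ((Real.pi : ℂ) ^ (-s) * Complex.Gamma s * (1 / 2 * epstein z s)) := by
  have hs0 : s ≠ 0 := Complex.ne_zero_of_re_pos (zero_lt_one.trans hs)
  have hs1 : s - 1 ≠ 0 := Complex.ne_zero_of_re_pos (by simpa using hs)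
  have hθ : IsTheta (thetaSeries (fun _ => 1) z) 1 := fun t ht => by
    rw [add_comm, one_add_thetaSeries_one_inv z ht, add_comm 1]
  have hmellin :=
    ((isSubexponential_const 1).decaysExponentially z).mellin_eq_symMellin hθ hs
  rw [mellin_thetaSeries_one z hs] at hmellin
  rw [completedZero, eq_sub_of_add_eq hmellin.symm]
  field_simp
  ring

lemma completedTwo_eq (z : ℍ) {s : ℂ} (hs : 0 < s.re) : completedTwo z s =
    (s + 1) * s * ((Real.pi : ℂ) ^ (-(s + 1)) * Complex.Gamma (s + 2) *
      eisensteinSeries 2 z s) := by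
  have hs1 : 1 < (s + 1).re := by simpa using hs
  have hθ : IsTheta (thetaSeries (xiCoeff z) z) 0 := fun t ht => by
    rw [add_zero, add_zero, thetaSeries_xiCoeff_inv z ht]
  have hmellin := ((isSubexponential_xiCoeff z).decaysExponentially z).mellin_eq_symMellin hθ hs1
  rw [mellin_thetaSeries_xiCoeff z hs1, zero_div, add_zero, ← symMellin_one_sub,
    sub_add_cancel_right, add_assoc s, one_add_one_eq_two] at hmellin
  rw [completedTwo, ← hmellin, eisensteinSeries_two]
  ring

lemma isDoublyCompleted_zero (z : ℍ) : IsDoublyCompleted 0 z (completedZero z) := by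
  refine ⟨differentiable_completedZero z, fun s hs => ?_⟩
  rw [completedZero_eq z (by simpa using hs), eisensteinSeries_zero]
  simp

lemma isDoublyCompleted_two (z : ℍ) : IsDoublyCompleted 2 z (completedTwo z) := by
  refine ⟨differentiable_completedTwo z, fun s hs => ?_⟩
  rw [completedTwo_eq z (by simpa using hs)]
  simp [add_assoc, one_add_one_eq_two]

lemma IsDoublyCompleted.doublyCompleted_eq {k : ℤ} {z : ℍ} {f : ℂ → ℂ}
    (hf : IsDoublyCompleted k z f) : doublyCompleted k z = f := by
  have hspec : IsDoublyCompleted k z (doublyCompleted k z) := Classical.epsilon_spec ⟨f, hf⟩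
  exact entire_eq_of_eq_on_halfPlane hspec.1 hf.1 fun s hs => (hspec.2 s hs).trans (hf.2 s hs).symm

lemma isDoublyCompleted_doublyCompleted_zero (z : ℍ) :
    IsDoublyCompleted 0 z (doublyCompleted 0 z) :=
  (isDoublyCompleted_zero z).doublyCompleted_eq ▸ isDoublyCompleted_zero z

lemma isDoublyCompleted_doublyCompleted_two (z : ℍ) :
    IsDoublyCompleted 2 z (doublyCompleted 2 z) :=
  (isDoublyCompleted_two z).doublyCompleted_eq ▸ isDoublyCompleted_two z

lemma F_eq_taylorAt (n : ℕ) (z : ℍ) : F n z = taylorAt n (completedZero z) := by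
  rw [F, taylorCoeff, (isDoublyCompleted_zero z).doublyCompleted_eq, taylorAt]

lemma symMellin_laplacianCoeff (z : ℍ) :
    symMellin (thetaSeries (laplacianCoeff z) z) = fun s => 2 * completedZero z s := by
  have hdecay := (isSubexponential_laplacianCoeff z).decaysExponentially z
  have hθ : IsTheta (thetaSeries (laplacianCoeff z) z) 0 := fun t ht => by
    rw [add_zero, add_zero, thetaSeries_laplacianCoeff_inv z ht]
  refine entire_eq_of_eq_on_halfPlane (c := 1) hdecay.differentiable_symMellin
    ((differentiable_completedZero z).const_mul 2) fun s hs => ?_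
  have hmellin := hdecay.mellin_eq_symMellin hθ hs
  rw [mellin_thetaSeries_laplacianCoeff z hs, zero_div, add_zero] at hmellin
  rw [← hmellin, completedZero_eq z hs]
  ring

lemma mellinCoeff_laplacianCoeff (n : ℕ) (z : ℍ) :
    mellinCoeff (laplacianCoeff z) n z = 2 * F n z := by
  rw [mellinCoeff, symMellin_laplacianCoeff, taylorAt_const_mul, F_eq_taylorAt]

lemma F_zero : F 0 = fun _ => 1 / 2 := by
  funext z
  simp [F_eq_taylorAt, taylorAt, completedZero]

lemma F_succ_eq_taylorAt (n : ℕ) (z : ℍ) : F (n + 1) z = 1 / 2 * taylorAt (n + 1)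
    (fun s => s * (s - 1) * symMellin (thetaSeries (fun _ => 1) z) s) := by
  rw [F_eq_taylorAt, ← taylorAt_const_mul, taylorAt, taylorAt]
  congr 1
  exact iteratedDeriv_const_add n.succ_pos _

lemma F_one : F 1 = fun z => -(1 / 2) * mellinCoeff (fun _ => 1) 0 z := by
  funext z
  rw [F_succ_eq_taylorAt 0, taylorAt_one_mul_sub_one_mul (differentiable_symMellin_one z),
    mellinCoeff, mul_neg, neg_mul]

lemma F_add_two (n : ℕ) : F (n + 2) = fun z => 1 / 2 * mellinCoeff (fun _ => 1) n z +
    -(1 / 2) * mellinCoeff (fun _ => 1) (n + 1) z := by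
  funext z
  rw [F_succ_eq_taylorAt, taylorAt_add_two_mul_sub_one_mul (differentiable_symMellin_one z),
    mellinCoeff, mellinCoeff]
  ring

lemma G_eq_taylorAt (n : ℕ) (z : ℍ) : G n z = (-1) ^ n * (1 / 2 * taylorAt n
    (fun s => s * (s - 1) * symMellin (thetaSeries (xiCoeff z) z) s)) := by
  rw [G, taylorCoeff, (isDoublyCompleted_two z).doublyCompleted_eq, ← taylorAt_const_mul,
    ← taylorAt_comp_neg]
  rfl

lemma G_zero (z : ℍ) : G 0 z = 0 := by
  rw [G_eq_taylorAt, taylorAt_zero_mul_sub_one_mul (differentiable_symMellin_xiCoeff z), mul_zero,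
    mul_zero]

lemma G_one (z : ℍ) : G 1 z = 1 / 2 * mellinCoeff (xiCoeff z) 0 z := by
  rw [G_eq_taylorAt, taylorAt_one_mul_sub_one_mul (differentiable_symMellin_xiCoeff z),
    mellinCoeff]
  ring

lemma G_add_two (n : ℕ) (z : ℍ) : G (n + 2) z = (-1) ^ n *
    (1 / 2 * mellinCoeff (xiCoeff z) n z + -(1 / 2) * mellinCoeff (xiCoeff z) (n + 1) z) := by
  rw [G_eq_taylorAt, taylorAt_add_two_mul_sub_one_mul (differentiable_symMellin_xiCoeff z),
    mellinCoeff, mellinCoeff]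
  ring

lemma isSmooth_F : ∀ n : ℕ, IsSmooth (F n)
  | 0 => by
    rw [F_zero]
    exact isSmooth_const _
  | 1 => by
    rw [F_one]
    exact (isSmooth_mellinCoeff 0).const_mul _
  | n + 2 => by
    rw [F_add_two]
    exact ((isSmooth_mellinCoeff n).const_mul _).add ((isSmooth_mellinCoeff (n + 1)).const_mul _)

lemma xi_F : ∀ (n : ℕ) (z : ℍ), xi 0 (F n) z = (-1) ^ n * G n z
  | 0, z => by rw [F_zero, xi_const, G_zero, mul_zero]
  | 1, z => by
    rw [F_one, xi_const_mul (isSmooth_mellinCoeff 0), xi_mellinCoeff, G_one]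
    simp [map_ofNat]
  | n + 2, z => by
    have hsmooth := isSmooth_mellinCoeff
    rw [F_add_two, xi_add ((hsmooth n).const_mul _) ((hsmooth (n + 1)).const_mul _),
      xi_const_mul (hsmooth n), xi_const_mul (hsmooth (n + 1)), xi_mellinCoeff, xi_mellinCoeff,
      G_add_two, pow_add, neg_one_sq, mul_one, ← mul_assoc, ← mul_pow]
    simp [map_ofNat]

lemma laplacian_F_zero (z : ℍ) : laplacian 0 (F 0) z = 0 := by
  rw [F_zero, laplacian_const]

lemma laplacian_F_one (z : ℍ) : laplacian 0 (F 1) z = -F 0 z := by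
  rw [F_one, laplacian_const_mul (isSmooth_mellinCoeff 0), laplacian_mellinCoeff,
    mellinCoeff_laplacianCoeff]
  ring

lemma laplacian_F_add_two (n : ℕ) (z : ℍ) :
    laplacian 0 (F (n + 2)) z = F n z - F (n + 1) z := by
  have hsmooth := isSmooth_mellinCoeff
  rw [F_add_two, laplacian_add ((hsmooth n).const_mul _) ((hsmooth (n + 1)).const_mul _),
    laplacian_const_mul (hsmooth n), laplacian_const_mul (hsmooth (n + 1)), laplacian_mellinCoeff,
    laplacian_mellinCoeff, mellinCoeff_laplacianCoeff, mellinCoeff_laplacianCoeff]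
  ring

end Completed

section Symmetrized

lemma add_sum_Icc_one (f : ℕ → ℂ) (n : ℕ) :
    f 0 + ∑ l ∈ Finset.Icc 1 n, f l = ∑ l ∈ Finset.range (n + 1), f l := by
  rw [Finset.sum_range_eq_add_Ico f n.succ_pos, Nat.succ_eq_add_one,
    Finset.Ico_add_one_right_eq_Icc]

lemma symF_eq_sum (n : ℕ) : symF n = fun z =>
    (-1) ^ n * ∑ l ∈ Finset.range (n + 1), ((n + l).choose n : ℂ) * F (n - l) z := by
  funext z
  rw [symF, ← add_sum_Icc_one]
  simp

lemma symG_eq_sum (n : ℕ) (z : ℍ) : symG n z =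
    ∑ l ∈ Finset.range (n + 1), (-1) ^ l * ((n + l).choose n : ℂ) * G (n - l) z := by
  rw [symG, ← add_sum_Icc_one]
  simp

lemma isSmooth_sum_choose_mul_F (n : ℕ) : IsSmooth fun z =>
    ∑ l ∈ Finset.range (n + 1), ((n + l).choose n : ℂ) * F (n - l) z :=
  IsSmooth.sum fun l _ => (isSmooth_F (n - l)).const_mul _

lemma isSmooth_symF (n : ℕ) : IsSmooth (symF n) := by
  rw [symF_eq_sum]
  exact (isSmooth_sum_choose_mul_F n).const_mul _

lemma xi_symF (n : ℕ) (z : ℍ) : xi 0 (symF n) z = symG n z := by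
  rw [symF_eq_sum, symG_eq_sum, xi_const_mul (isSmooth_sum_choose_mul_F n),
    xi_sum fun l _ => (isSmooth_F (n - l)).const_mul _, Finset.mul_sum]
  refine Finset.sum_congr rfl fun l hl => ?_
  have hsign : (-1 : ℂ) ^ n * (-1) ^ (n - l) = (-1) ^ l := by
    obtain ⟨m, rfl⟩ := Nat.exists_eq_add_of_le (Nat.lt_succ_iff.1 (Finset.mem_range.1 hl))
    rw [Nat.add_sub_cancel_left, pow_add, mul_assoc, ← mul_pow]
    simp
  rw [xi_const_mul (isSmooth_F _), xi_F, ← hsign]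
  simp only [map_pow, map_neg, map_one, map_natCast]
  ring

lemma laplacian_symF_eq_sum (n : ℕ) (z : ℍ) : laplacian 0 (symF n) z = (-1) ^ n *
    ∑ l ∈ Finset.range (n + 1), ((n + l).choose n : ℂ) * laplacian 0 (F (n - l)) z := by
  rw [symF_eq_sum, laplacian_const_mul (isSmooth_sum_choose_mul_F n),
    laplacian_sum fun l _ => (isSmooth_F (n - l)).const_mul _]
  simp only [laplacian_const_mul (isSmooth_F _)]

lemma sum_choose_mul_sub_succ (f : ℕ → ℂ) (n : ℕ) :
    ∑ l ∈ Finset.range n, ((n + 1 + l).choose (n + 1) : ℂ) * f (n - (l + 1)) =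
      ∑ l ∈ Finset.range (n + 1), ((n + l).choose (n + 1) : ℂ) * f (n - l) := by
  rw [Finset.sum_range_succ' _ n]
  simp [add_right_comm n 1, add_assoc n]

-- After reindexing, `f (n - l)` occurs with coefficient
-- `(n + l).choose (n + 1) - (n + 1 + l).choose (n + 1)`, which Pascal's rule evaluates.
lemma sum_choose_mul_of_recurrence {f h : ℕ → ℂ} (h_zero : h 0 = 0) (h_one : h 1 = -f 0)
    (h_add_two : ∀ m, h (m + 2) = f m - f (m + 1)) (n : ℕ) :
    ∑ l ∈ Finset.range (n + 2), ((n + 1 + l).choose (n + 1) : ℂ) * h (n + 1 - l) =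
      -∑ l ∈ Finset.range (n + 1), ((n + l).choose n : ℂ) * f (n - l) := by
  have h_sub (l) (hl : l ∈ Finset.range n) : h (n + 1 - l) = f (n - (l + 1)) - f (n - l) := by
    obtain ⟨m, rfl⟩ := Nat.exists_eq_add_of_lt (Finset.mem_range.1 hl)
    rw [show l + m + 1 + 1 - l = m + 2 by lia, h_add_two, show l + m + 1 - (l + 1) = m by lia,
      show l + m + 1 - l = m + 1 by lia]
  calc ∑ l ∈ Finset.range (n + 2), ((n + 1 + l).choose (n + 1) : ℂ) * h (n + 1 - l)
    _ = ∑ l ∈ Finset.range n, ((n + 1 + l).choose (n + 1) : ℂ) * (f (n - (l + 1)) - f (n - l)) -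
        ((n + 1 + n).choose (n + 1) : ℂ) * f (n - n) := by
      rw [Finset.sum_range_succ, Finset.sum_range_succ, Nat.sub_self, h_zero,
        Nat.add_sub_cancel_left, h_one, Nat.sub_self,
        Finset.sum_congr rfl fun l hl => by rw [h_sub l hl]]
      ring
    _ = ∑ l ∈ Finset.range (n + 1), ((n + l).choose (n + 1) : ℂ) * f (n - l) -
        ∑ l ∈ Finset.range (n + 1), ((n + 1 + l).choose (n + 1) : ℂ) * f (n - l) := by
      rw [← sum_choose_mul_sub_succ, Finset.sum_range_succ (n := n)]
      simp only [mul_sub, Finset.sum_sub_distrib]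
      ring
    _ = -∑ l ∈ Finset.range (n + 1), ((n + l).choose n : ℂ) * f (n - l) := by
      rw [← Finset.sum_sub_distrib, ← Finset.sum_neg_distrib]
      refine Finset.sum_congr rfl fun l _ => ?_
      rw [add_right_comm n 1, Nat.choose_succ_succ, Nat.cast_add]
      ring

lemma laplacian_symF_succ (n : ℕ) (z : ℍ) : laplacian 0 (symF (n + 1)) z = symF n z := by
  rw [laplacian_symF_eq_sum, symF_eq_sum, sum_choose_mul_of_recurrence (f := fun m => F m z)
    (h := fun m => laplacian 0 (F m) z) (laplacian_F_zero z) (laplacian_F_one z)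
    fun m => laplacian_F_add_two m z]
  ring

lemma laplacian_symF_zero (z : ℍ) : laplacian 0 (symF 0) z = 0 := by
  simp [laplacian_symF_eq_sum, laplacian_F_zero]

lemma symG_eq_xi_symF (n : ℕ) : symG n = xi 0 (symF n) := funext fun z => (xi_symF n z).symm

lemma isSmooth_symG (n : ℕ) : IsSmooth (symG n) := by
  rw [symG_eq_xi_symF]
  exact isSmooth_xi_zero (isSmooth_symF n)

lemma xi_symG (n : ℕ) (z : ℍ) : xi 2 (symG n) z = laplacian 0 (symF n) z := by
  rw [symG_eq_xi_symF, xi_two_xi_zero (isSmooth_symF n)]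

lemma xi_symG_succ (n : ℕ) (z : ℍ) : xi 2 (symG (n + 1)) z = symF n z := by
  rw [xi_symG, laplacian_symF_succ]

lemma xi_symG_zero (z : ℍ) : xi 2 (symG 0) z = 0 := by
  rw [xi_symG, laplacian_symF_zero]

lemma laplacian_symG_succ (n : ℕ) (z : ℍ) : laplacian 2 (symG (n + 1)) z = symG n z := by
  rw [← xi_zero_xi_two (isSmooth_symG _), funext (xi_symG_succ n), xi_symF]

lemma laplacian_symG_zero (z : ℍ) : laplacian 2 (symG 0) z = 0 := by
  rw [← xi_zero_xi_two (isSmooth_symG _), funext xi_symG_zero, xi_const]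

end Symmetrized

end PolyharmonicMaass

theorem theorem1p3 :
    -- the doubly completed Eisenstein series exist as entire functions of `s`
    (∀ z : UpperHalfPlane,
      PolyharmonicMaass.IsDoublyCompleted 0 z (PolyharmonicMaass.doublyCompleted 0 z) ∧
      PolyharmonicMaass.IsDoublyCompleted 2 z (PolyharmonicMaass.doublyCompleted 2 z)) ∧
    -- the differential operators are applied to smooth functions
    (∀ n : ℕ, PolyharmonicMaass.IsSmooth (PolyharmonicMaass.symF n) ∧
      PolyharmonicMaass.IsSmooth (PolyharmonicMaass.symG n)) ∧
    -- weight `0`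
    (∀ (n : ℕ) (z : UpperHalfPlane),
      PolyharmonicMaass.laplacian 0 (PolyharmonicMaass.symF (n + 1)) z =
        PolyharmonicMaass.symF n z) ∧
    (∀ (n : ℕ) (z : UpperHalfPlane),
      PolyharmonicMaass.xi 0 (PolyharmonicMaass.symF n) z = PolyharmonicMaass.symG n z) ∧
    -- weight `2`
    (∀ (n : ℕ) (z : UpperHalfPlane),
      PolyharmonicMaass.laplacian 2 (PolyharmonicMaass.symG (n + 1)) z =
        PolyharmonicMaass.symG n z) ∧
    (∀ (n : ℕ) (z : UpperHalfPlane),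
      PolyharmonicMaass.xi 2 (PolyharmonicMaass.symG (n + 1)) z =
        PolyharmonicMaass.symF n z) ∧
    -- the case `n = 0`, where the functions of index `-1` are zero
    (∀ z : UpperHalfPlane,
      PolyharmonicMaass.laplacian 0 (PolyharmonicMaass.symF 0) z = 0 ∧
      PolyharmonicMaass.laplacian 2 (PolyharmonicMaass.symG 0) z = 0 ∧
      PolyharmonicMaass.xi 2 (PolyharmonicMaass.symG 0) z = 0) := by
  open PolyharmonicMaass in
  exact ⟨fun z => ⟨isDoublyCompleted_doublyCompleted_zero z,
      isDoublyCompleted_doublyCompleted_two z⟩,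
    fun n => ⟨isSmooth_symF n, isSmooth_symG n⟩,
    laplacian_symF_succ, xi_symF, laplacian_symG_succ, xi_symG_succ,
    fun z => ⟨laplacian_symF_zero z, laplacian_symG_zero z, xi_symG_zero z⟩⟩
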